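/- **Setting.** Let $\Omega$ be a star graph with $n\ge 1$ edges; edge $i$ is the interval $[0,\ell_i]$, $\ell_i>0$, with $0$ at the common vertex, and let $V_i\in L^1(0,\ell_i)$ be (possibly complex-valued) potentials. Boundary conditions $\Gamma$ are given by complex $n\times n$ matrices $\alpha_1,\alpha_2,\beta_1,\beta_2$ with $\operatorname{rank}[\alpha_1\ \alpha_2]=\operatorname{rank}[\beta_1\ \beta_2]=n$, $\alpha_1\alpha_2^*=\alpha_2\alpha_1^*$, $\beta_1\beta_2^*=\beta_2\beta_1^*$ and $\beta_1,\beta_2$ diagonal; $u=(u_1,\dots,u_n)$ satisfies $\Gamma$ if $\alpha_1u(0)+\alpha_2u'(0)=0$ and $\beta_1u(\ell)+\beta_2u'(\ell)=0$, where $u(\ell)=(u_i(\ell_i))_i$. The operator $H^\Omega_\Gamma$ acts in $L^2(\Omega)=\bigoplus_i L^2(0,\ell_i)$ by $(H^\Omega_\Gamma u)_i=-u_i''+V_iu_i$; its domain consists of the $u$ satisfying $\Gamma$ such that, for all $i$, $u_i\in W^{2,1}(0,\ell_i)$ and $-u_i''+V_iu_i\in L^2(0,\ell_i)$ (if $V_i\in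 L^2$ for all $i$, this means $u_i\in H^2(0,\ell_i)$). *Evans function.* For $\lambda\in\mathbb C$ let $Y(x,\lambda)$ and $Z(x,\lambda)$ be the $n\times n$ matrices whose columns solve $-u_k''+V_ku_k=\lambda u_k$ on each edge $k$ and for which $Y(0)=-\alpha_2^*$, $Y'(0)=\alpha_1^*$, $Z(\ell)=-\beta_2^*$, $Z'(\ell)=\beta_1^*$ (row $k$ is a function of the point $x_k\in[0,\ell_k]$ of edge $k$). The Evans function is $$E^\Omega_\Gamma(\lambda)=\det\begin{bmatrix}Y(x,\lambda)&Z(x,\lambda)\\Y'(x,\lambda)&Z'(x,\lambda)\end{bmatrix},$$ which does not depend on the points $x=(x_1,\dots,x_n)$. *Splitting.* Let $0<s_1<\ell_j$. Let $\Omega_1$ be the interval $[s_1,\ell_j]$ of edge $j$, a star graph with one edge in which $s_1$ plays the role of $0$, and let $\Omega_2$ be $\Omega$ with edge $j$ replaced by $[0,s_1]$, with $s_1$ in the role of $\ell_j$; both carry the restricted potentials. The conditions $\Gamma_1$ on $\Omega_1$ are $u(s_1)=0$ (that is, $\alpha_1=1$, $\alpha_2=0$) and the condition of $\Gamma$ at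 $\ell_j$ (the $1\times1$ matrices $(\beta_1)_{jj},(\beta_2)_{jj}$). The conditions $\Gamma_2$ on $\Omega_2$ have the same $\alpha_1,\alpha_2$ as $\Gamma$ and the same $\beta_1,\beta_2$ except that their $j$-th diagonal entries are replaced by $1$ and $0$ (that is, $u_j(s_1)=0$). Operators and Evans functions on $\Omega_1,\Omega_2$ are defined as on $\Omega$, with the changed end points. *Two-sided map.* Let $\rho(\cdot)$ denote the resolvent set. For $\lambda\in\rho(H^{\Omega_1}_{\Gamma_1})$ and $f\in\mathbb C$ put $M_1(\lambda)f=-u'(s_1)$, where $u$ is the unique solution of $-u''+V_ju=\lambda u$ on $\Omega_1$ with $u(s_1)=f$ that satisfies the condition at $\ell_j$. For $\lambda\in\rho(H^{\Omega_2}_{\Gamma_2})$ put $M_2(\lambda)f=u_j'(s_1)$, where $u$ is the unique solution of $-u_i''+V_iu_i=\lambda u_i$ ($1\le i\le n$) on $\Omega_2$ with $u_j(s_1)=f$ that satisfies the conditions of $\Gamma$ at $0$ and at $\ell_i$, $i\neq j$. **Theorem.** For every $\lambda\in\rho(H^{\Omega_1}_{\Gamma_1})\cap\rho(H^{\Omega_2}_{\Gamma_2})$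 the boundary value problems that define $M_1(\lambda)$ and $M_2(\lambda)$ are uniquely solvable, $E^{\Omega_1}_{\Gamma_1}(\lambda)E^{\Omega_2}_{\Gamma_2}(\lambda)\ne0$, and $(M_1+M_2)(\lambda):\mathbb C\to\mathbb C$ is multiplication by $$(M_1+M_2)(\lambda)=\frac{E^{\Omega}_{\Gamma}(\lambda)}{E^{\Omega_1}_{\Gamma_1}(\lambda)\,E^{\Omega_2}_{\Gamma_2}(\lambda)} .$$ Moreover the complement of $\rho(H^{\Omega_1}_{\Gamma_1})\cap\rho(H^{\Omega_2}_{\Gamma_2})$ in $\mathbb C$ is closed and discrete, both sides are meromorphic on $\mathbb C$, and they are equal as meromorphic functions on $\mathbb C$. -/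

import Mathlib

open MeasureTheory Set Filter Topology

noncomputable section

namespace QuantumStar

/-! ### Functions on one edge -/

/-- `u` belongs to the Sobolev space `W^{2,1}(a,b)`: `u` is (the continuous representative of) a
continuously differentiable function on `[a,b]` with derivative `u'` (one-sided at the end points),
and `u'` is absolutely continuous with integrable almost-everywhere derivative `u''`. -/
structure IsW21 (a b : ℝ) (u u' u'' : ℝ → ℂ) : Prop where
  integrableOn : IntegrableOn u'' (Ioo a b)
  hasDeriv : ∀ x ∈ Icc a b, HasDerivWithinAt u (u' x) (Icc a b) x
  integral_eq : ∀ x ∈ Icc a b, u' x = u' a + ∫ t in a..x, u'' t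

/-- `u`, with derivative `u'`, solves `-u'' + V u = z u` on `[a,b]`. -/
def IsEdgeSolution (V : ℝ → ℂ) (z : ℂ) (a b : ℝ) (u u' : ℝ → ℂ) : Prop :=
  IsW21 a b u u' (fun x => (V x - z) * u x)

/-- `w = (u, u')` solves the initial value problem `-u'' + V u = z u` on `[a,b]`,
`u x₀ = c`, `u' x₀ = d`. -/
def IsIVPSolution (V : ℝ → ℂ) (z : ℂ) (a b x₀ : ℝ) (c d : ℂ) (w : (ℝ → ℂ) × (ℝ → ℂ)) : Prop :=
  IsEdgeSolution V z a b w.1 w.2 ∧ w.1 x₀ = c ∧ w.2 x₀ = d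

open Classical in
/-- The solution `(u, u')` of the initial value problem. -/
def ivpSolution (V : ℝ → ℂ) (z : ℂ) (a b x₀ : ℝ) (c d : ℂ) : (ℝ → ℂ) × (ℝ → ℂ) :=
  if h : ∃ w, IsIVPSolution V z a b x₀ c d w then h.choose else 0

/-! ### Star graphs and boundary conditions -/

/-- A metric star graph with edges indexed by `ι` and a potential on it. Edge `i` is the interval
`[inner i, outer i]`; the end points `inner i` are at the central vertex. -/
structure StarGraph (ι : Type) where
  inner : ι → ℝ
  outer : ι → ℝ
  potential : ι → ℝ → ℂ

/-- The matrices `α₁, α₂` (central vertex) and `β₁, β₂` (outer vertices). -/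
structure BoundaryConditions (ι : Type) where
  α₁ : Matrix ι ι ℂ
  α₂ : Matrix ι ι ℂ
  β₁ : Matrix ι ι ℂ
  β₂ : Matrix ι ι ℂ

/-- Separated self-adjoint boundary conditions, local at the outer vertices. -/
structure BoundaryConditions.IsSelfAdjoint {ι : Type} [Fintype ι] [DecidableEq ι]
    (Γ : BoundaryConditions ι) : Prop where
  rank_α : (Matrix.fromCols Γ.α₁ Γ.α₂).rank = Fintype.card ι
  rank_β : (Matrix.fromCols Γ.β₁ Γ.β₂).rank = Fintype.card ι
  comm_α : Γ.α₁ * Γ.α₂.conjTranspose = Γ.α₂ * Γ.α₁.conjTranspose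
  comm_β : Γ.β₁ * Γ.β₂.conjTranspose = Γ.β₂ * Γ.β₁.conjTranspose
  diag_β₁ : Γ.β₁.IsDiag
  diag_β₂ : Γ.β₂.IsDiag

section

variable {ι : Type} [Fintype ι] [DecidableEq ι]

/-- The `Γ`-trace of a function `u` with derivative `u'`; the first block of entries belongs to
the outer vertices, the second one to the central vertex. -/
def trace (G : StarGraph ι) (Γ : BoundaryConditions ι) (u u' : ι → ℝ → ℂ) : ι ⊕ ι → ℂ :=
  Sum.elim
    (Γ.β₁.mulVec (fun i => u i (G.outer i)) + Γ.β₂.mulVec (fun i => u' i (G.outer i)))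
    (Γ.α₁.mulVec (fun i => u i (G.inner i)) + Γ.α₂.mulVec (fun i => u' i (G.inner i)))

/-- `x` is a choice of one point on every edge. -/
def IsPoint (G : StarGraph ι) (x : ι → ℝ) : Prop :=
  ∀ i, x i ∈ Icc (G.inner i) (G.outer i)

/-! ### The Schrödinger operator and its resolvent set -/

/-- The Hilbert space `L²` of the graph. -/
abbrev L2 (G : StarGraph ι) : Type :=
  PiLp 2 (fun i => Lp ℂ 2 (volume.restrict (Ioo (G.inner i) (G.outer i))))

/-- `(φ, f)` belongs to the graph of the Schrödinger operator: `φ` is represented by `u`, which is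
in `W^{2,1}` of every edge and satisfies the boundary conditions, and `f = -u'' + V u`. -/
def InOperatorGraph (G : StarGraph ι) (Γ : BoundaryConditions ι) (φ f : L2 G) : Prop :=
  ∃ u u' u'' : ι → ℝ → ℂ,
    (∀ i, IsW21 (G.inner i) (G.outer i) (u i) (u' i) (u'' i)) ∧
    (∀ i, φ i =ᵐ[volume.restrict (Ioo (G.inner i) (G.outer i))] u i) ∧
    (∀ i, f i =ᵐ[volume.restrict (Ioo (G.inner i) (G.outer i))]
      fun x => -u'' i x + G.potential i x * u i x) ∧
    trace G Γ u u' = 0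

end

lemma IsW21.intervalIntegrable {a b : ℝ} {u u' u'' : ℝ → ℂ} (h : IsW21 a b u u' u'')
    {x : ℝ} (hx : x ∈ Icc a b) : IntervalIntegrable u'' volume a x := by
  rw [intervalIntegrable_iff_integrableOn_Ioo_of_le hx.1]
  exact h.integrableOn.mono_set (Ioo_subset_Ioo_right hx.2)

lemma IsW21.add {a b : ℝ} {u u' u'' v v' v'' : ℝ → ℂ} (h : IsW21 a b u u' u'')
    (k : IsW21 a b v v' v'') : IsW21 a b (u + v) (u' + v') (u'' + v'') where
  integrableOn := h.integrableOn.add k.integrableOn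
  hasDeriv x hx := (h.hasDeriv x hx).add (k.hasDeriv x hx)
  integral_eq x hx := by
    simp only [Pi.add_apply]
    rw [intervalIntegral.integral_add (h.intervalIntegrable hx) (k.intervalIntegrable hx),
      h.integral_eq x hx, k.integral_eq x hx]
    ring

lemma IsW21.smul {a b : ℝ} {u u' u'' : ℝ → ℂ} (c : ℂ) (h : IsW21 a b u u' u'') :
    IsW21 a b (c • u) (c • u') (c • u'') where
  integrableOn := h.integrableOn.smul c
  hasDeriv x hx := (h.hasDeriv x hx).const_smul c
  integral_eq x hx := by
    simp only [Pi.smul_apply]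
    rw [intervalIntegral.integral_smul, h.integral_eq x hx, smul_add]

lemma IsW21.zero (a b : ℝ) : IsW21 a b 0 0 0 where
  integrableOn := integrableOn_zero
  hasDeriv x _ := hasDerivWithinAt_const x _ 0
  integral_eq x _ := by simp

lemma IsW21.ae_eq_zero {a b : ℝ} {u u' u'' : ℝ → ℂ} (h : IsW21 a b u u' u'')
    (hu : u =ᵐ[volume.restrict (Ioo a b)] 0) :
    u'' =ᵐ[volume.restrict (Ioo a b)] 0 := by
  have h0 : ∀ x ∈ Ioo a b, u x = 0 := by
    have hc : ContinuousOn u (Ioo a b) := fun x hx =>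
      ((h.hasDeriv x (Ioo_subset_Icc_self hx)).continuousWithinAt).mono Ioo_subset_Icc_self
    exact Measure.eqOn_open_of_ae_eq hu isOpen_Ioo hc continuousOn_const
  have h1 : ∀ x ∈ Ioo a b, u' x = 0 := by
    intro x hx
    have hd : HasDerivAt u (u' x) x :=
      (h.hasDeriv x (Ioo_subset_Icc_self hx)).hasDerivAt (Icc_mem_nhds hx.1 hx.2)
    have hz : HasDerivAt u 0 x :=
      (hasDerivAt_const x (0 : ℂ)).congr_of_eventuallyEq
        (by filter_upwards [isOpen_Ioo.mem_nhds hx] with y hy using h0 y hy)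
    exact hd.unique hz
  rcases lt_or_ge a b with hab | hab
  · have hI : IntervalIntegrable u'' volume a b := h.intervalIntegrable ⟨hab.le, le_rfl⟩
    have hL := hI.ae_hasDerivAt_integral
    rw [Filter.EventuallyEq, ae_restrict_iff' measurableSet_Ioo]
    filter_upwards [hL] with x hx hxab
    have hx1 := hx (by rw [uIcc_of_le hab.le]; exact Ioo_subset_Icc_self hxab) a
      (by rw [uIcc_of_le hab.le]; exact ⟨le_rfl, hab.le⟩)
    have hz : HasDerivAt (fun y => ∫ t in a..y, u'' t) 0 x := by
      refine (hasDerivAt_const x (-u' a)).congr_of_eventuallyEq ?_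
      filter_upwards [isOpen_Ioo.mem_nhds hxab] with y hy
      have := h.integral_eq y (Ioo_subset_Icc_self hy)
      rw [h1 y hy] at this
      linear_combination -this
    exact hx1.unique hz
  · rw [Ioo_eq_empty_of_le hab, Measure.restrict_empty, Filter.EventuallyEq, ae_zero]
    exact eventually_bot

section

variable {ι : Type} [Fintype ι] [DecidableEq ι]

lemma trace_add (G : StarGraph ι) (Γ : BoundaryConditions ι) (u u' v v' : ι → ℝ → ℂ) :
    trace G Γ (u + v) (u' + v') = trace G Γ u u' + trace G Γ v v' := by
  ext (i | i) <;>
    simp only [trace, Matrix.mulVec, dotProduct, Pi.add_apply, Sum.elim_inl, Sum.elim_inr, mul_add,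
      Finset.sum_add_distrib] <;> ring

lemma trace_smul (G : StarGraph ι) (Γ : BoundaryConditions ι) (c : ℂ) (u u' : ι → ℝ → ℂ) :
    trace G Γ (c • u) (c • u') = c • trace G Γ u u' := by
  ext (i | i) <;>
    simp only [trace, Matrix.mulVec, dotProduct, Pi.add_apply, Pi.smul_apply, Sum.elim_inl,
      Sum.elim_inr, smul_eq_mul, mul_add, Finset.mul_sum, mul_left_comm c]

/-- The graph of the Schrödinger operator as a subspace of `L² × L²`. -/
def operatorGraph (G : StarGraph ι) (Γ : BoundaryConditions ι) : Submodule ℂ (L2 G × L2 G) where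
  carrier := {p | InOperatorGraph G Γ p.1 p.2}
  zero_mem' := by
    refine ⟨0, 0, 0, fun i => IsW21.zero _ _, fun i => ?_, fun i => ?_, ?_⟩
    · exact Lp.coeFn_zero _ _ _
    · refine (Lp.coeFn_zero ℂ 2 _).trans (Eventually.of_forall fun x => ?_)
      simp
    · simpa using trace_smul G Γ 0 0 0
  add_mem' := by
    rintro p q ⟨u, u', u'', hu, hp, hf, ht⟩ ⟨v, v', v'', hv, hq, hg, hs⟩
    refine ⟨u + v, u' + v', u'' + v'', fun i => (hu i).add (hv i), fun i => ?_, fun i => ?_, ?_⟩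
    · refine (Lp.coeFn_add (p.1 i) (q.1 i)).trans ?_
      filter_upwards [hp i, hq i] with x h1 h2
      simp [h1, h2]
    · refine (Lp.coeFn_add (p.2 i) (q.2 i)).trans ?_
      filter_upwards [hf i, hg i] with x h1 h2
      simp only [Pi.add_apply, h1, h2]
      ring
    · rw [trace_add, ht, hs, add_zero]
  smul_mem' := by
    rintro c p ⟨u, u', u'', hu, hp, hf, ht⟩
    refine ⟨c • u, c • u', c • u'', fun i => (hu i).smul c, fun i => ?_, fun i => ?_, ?_⟩
    · refine (Lp.coeFn_smul c (p.1 i)).trans ?_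
      filter_upwards [hp i] with x h1
      simp [h1]
    · refine (Lp.coeFn_smul c (p.2 i)).trans ?_
      filter_upwards [hf i] with x h1
      simp only [Pi.smul_apply, h1, smul_eq_mul]
      ring
    · rw [trace_smul, ht, smul_zero]

/-- The Schrödinger operator `H u = -u'' + V u` as an unbounded operator in `L²`, with domain
the functions `u` in `W^{2,1}` of every edge that satisfy the boundary conditions and have
`-u'' + V u` in `L²`. (If the potential is in `L²`, these are the functions in `H²` that
satisfy the boundary conditions.) -/
def schrodinger (G : StarGraph ι) (Γ : BoundaryConditions ι) : L2 G →ₗ.[ℂ] L2 G :=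
  (operatorGraph G Γ).toLinearPMap

/-- The subspace `operatorGraph` is the graph of the operator `schrodinger`. -/
lemma schrodinger_graph (G : StarGraph ι) (Γ : BoundaryConditions ι) :
    (schrodinger G Γ).graph = operatorGraph G Γ := by
  refine Submodule.toLinearPMap_graph_eq _ ?_
  rintro ⟨φ, f⟩ ⟨u, u', u'', hu, hp, hf, -⟩ hφ
  obtain rfl : φ = 0 := hφ
  ext i : 1
  refine Lp.ext ?_
  have h0 : u i =ᵐ[volume.restrict (Ioo (G.inner i) (G.outer i))] 0 :=
    (hp i).symm.trans (Lp.coeFn_zero ℂ 2 _)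
  refine (hf i).trans (EventuallyEq.trans ?_ (Lp.coeFn_zero ℂ 2 _).symm)
  filter_upwards [h0, (hu i).ae_eq_zero h0] with x h1 h2
  simp [h1, h2]

/-- The resolvent set of an unbounded operator `A`: those `z` for which `A - z` is a bijection
from the domain of `A` onto the whole space with bounded inverse `R`. -/
def operatorResolventSet {E : Type} [NormedAddCommGroup E] [NormedSpace ℂ E] (A : E →ₗ.[ℂ] E) : Set ℂ :=
  {z | ∃ R : E →L[ℂ] E,
    (∀ v, ∃ h : R v ∈ A.domain, A ⟨R v, h⟩ - z • R v = v) ∧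
    ∀ u : A.domain, R (A u - z • (u : E)) = u}

/-! ### The Evans function -/

/-- The solution `(u, u')`, `u = y_i`, on edge `k` determined by column `i` of
`[-α₂ᴴ; α₁ᴴ]` as initial data at the central vertex. -/
def solY (G : StarGraph ι) (Γ : BoundaryConditions ι) (z : ℂ) (k i : ι) : (ℝ → ℂ) × (ℝ → ℂ) :=
  ivpSolution (G.potential k) z (G.inner k) (G.outer k) (G.inner k)
    ((-Γ.α₂.conjTranspose) k i) (Γ.α₁.conjTranspose k i)

/-- The solution `(u, u')`, `u = z_i`, on edge `k` determined by column `i` of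
`[-β₂ᴴ; β₁ᴴ]` as initial data at the outer vertices. -/
def solZ (G : StarGraph ι) (Γ : BoundaryConditions ι) (z : ℂ) (k i : ι) : (ℝ → ℂ) × (ℝ → ℂ) :=
  ivpSolution (G.potential k) z (G.inner k) (G.outer k) (G.outer k)
    ((-Γ.β₂.conjTranspose) k i) (Γ.β₁.conjTranspose k i)

/-- The fundamental matrix `[Y Z; Y' Z']` at the points `x k` of the edges `k`. -/
def fundamentalMatrix (G : StarGraph ι) (Γ : BoundaryConditions ι) (x : ι → ℝ) (z : ℂ) :
    Matrix (ι ⊕ ι) (ι ⊕ ι) ℂ :=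
  Matrix.fromBlocks
    (Matrix.of fun k i => (solY G Γ z k i).1 (x k)) (Matrix.of fun k i => (solZ G Γ z k i).1 (x k))
    (Matrix.of fun k i => (solY G Γ z k i).2 (x k)) (Matrix.of fun k i => (solZ G Γ z k i).2 (x k))

/-- The Evans function, computed at the points `x k` of the edges `k`. -/
def evans (G : StarGraph ι) (Γ : BoundaryConditions ι) (x : ι → ℝ) (z : ℂ) : ℂ :=
  (fundamentalMatrix G Γ x z).det

/-! ### Boundary value problems -/

/-- `u`, with derivative `u'`, solves `(H - z) u = 0` on the graph and has `Γ`-trace `f`. -/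
def IsBVPSolution (G : StarGraph ι) (Γ : BoundaryConditions ι) (z : ℂ) (f : ι ⊕ ι → ℂ)
    (u u' : ι → ℝ → ℂ) : Prop :=
  (∀ i, IsEdgeSolution (G.potential i) z (G.inner i) (G.outer i) (u i) (u' i)) ∧
    trace G Γ u u' = f

/-- The problem `(H - z) u = 0` with `Γ`-trace `f` has exactly one solution on the graph. -/
def HasUniqueBVPSolution (G : StarGraph ι) (Γ : BoundaryConditions ι) (z : ℂ)
    (f : ι ⊕ ι → ℂ) : Prop :=
  (∃ u u', IsBVPSolution G Γ z f u u') ∧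
    ∀ u u' v v', IsBVPSolution G Γ z f u u' → IsBVPSolution G Γ z f v v' →
      ∀ i, EqOn (u i) (v i) (Icc (G.inner i) (G.outer i))

/-! ### Splitting a star graph at the point `s` of edge `j` -/

/-- The piece `[s, outer j]` of edge `j`, with `s` in the role of the central vertex. -/
def outerGraph (G : StarGraph ι) (j : ι) (s : ℝ) : StarGraph (Fin 1) where
  inner _ := s
  outer _ := G.outer j
  potential _ := G.potential j

/-- The conditions of `Γ` at the outer vertex of edge `j`, and `u(s) = 0` at `s`. -/
def outerConditions (Γ : BoundaryConditions ι) (j : ι) : BoundaryConditions (Fin 1) where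
  α₁ := 1
  α₂ := 0
  β₁ := Matrix.diagonal fun _ => Γ.β₁ j j
  β₂ := Matrix.diagonal fun _ => Γ.β₂ j j

/-- The remaining star graph, whose edge `j` ends at `s`. -/
def innerGraph (G : StarGraph ι) (j : ι) (s : ℝ) : StarGraph ι where
  inner := G.inner
  outer := Function.update G.outer j s
  potential := G.potential

/-- The conditions of `Γ` at the central vertex and at the outer vertices of the edges other
than `j`, and `u_j(s) = 0` at `s` (the matrices `β₁, β₂` of `Γ` being diagonal). -/
def innerConditions (Γ : BoundaryConditions ι) (j : ι) : BoundaryConditions ι where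
  α₁ := Γ.α₁
  α₂ := Γ.α₂
  β₁ := Matrix.diagonal (Function.update Γ.β₁.diag j 1)
  β₂ := Matrix.diagonal (Function.update Γ.β₂.diag j 0)

/-- Boundary data on the outer piece: value `f` at `s`, zero at the outer vertex. -/
def outerData (f : ℂ) : Fin 1 ⊕ Fin 1 → ℂ := Pi.single (Sum.inr 0) f

/-- Boundary data on the inner piece: value `f` at the end `s` of edge `j`, zero elsewhere. -/
def innerData (j : ι) (f : ℂ) : ι ⊕ ι → ℂ := Pi.single (Sum.inl j) f

open Classical in
/-- The one-sided map `M₁(z) f = -u'(s)`, where `(H - z) u = 0` on the outer piece, `u(s) = f`,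
and `u` satisfies the condition at the outer vertex. -/
def outerMap (G : StarGraph ι) (Γ : BoundaryConditions ι) (j : ι) (s : ℝ) (z f : ℂ) : ℂ :=
  if h : ∃ w : (Fin 1 → ℝ → ℂ) × (Fin 1 → ℝ → ℂ),
      IsBVPSolution (outerGraph G j s) (outerConditions Γ j) z (outerData f) w.1 w.2
  then -h.choose.2 0 s else 0

open Classical in
/-- The one-sided map `M₂(z) f = u_j'(s)`, where `(H - z) u = 0` on the inner piece, `u_j(s) = f`,
and `u` satisfies the conditions at all the other vertices. -/
def innerMap (G : StarGraph ι) (Γ : BoundaryConditions ι) (j : ι) (s : ℝ) (z f : ℂ) : ℂ :=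
  if h : ∃ w : (ι → ℝ → ℂ) × (ι → ℝ → ℂ),
      IsBVPSolution (innerGraph G j s) (innerConditions Γ j) z (innerData j f) w.1 w.2
  then h.choose.2 j s else 0

/-- The two-sided map `M₁ + M₂` at the point `s` of edge `j`. -/
def twoSidedMap (G : StarGraph ι) (Γ : BoundaryConditions ι) (j : ι) (s : ℝ) (z f : ℂ) : ℂ :=
  outerMap G Γ j s z f + innerMap G Γ j s z f

end

end QuantumStar

end

open QuantumStar

/-! ### Absolutely continuous functions -/

/-! Let `ζ` be the diagonal entry `z_j` of `Z` on edge `j`, the solution that satisfies the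
condition at `ℓ_j`. On the outer piece every admissible solution is a multiple of `ζ`, so `M₁ =
-ζ'(s₁)/ζ(s₁)`, and the `2 × 2` determinant at `s₁` is `E₁ = -ζ(s₁)`.

On the inner piece the fundamental matrix `F`, taken at the outer ends, has the unit vector `e'_j`
(derivative slot of edge `j`) as its `j`-th `Z` column, and `E₂ = det F`. A solution with value `f`
at `s₁` amounts to a vector `(c, -d)` with `F (c, -d) = f e_j` (value slot) and `d_j = u_j'(s₁)`.
Cramer's rule gives `M₂ = -N/E₂`, where `N` (`neumannDet`) is `det F` with that column replaced by
`e_j`. The fundamental matrix of the whole graph, at the same points, differs from `F` only in this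
column, which becomes `ζ(s₁) e_j + ζ'(s₁) e'_j`; the other `Z` columns agree because the `β`
matrices are diagonal. Linearity of the determinant in a column gives `E = ζ(s₁) N + ζ'(s₁) E₂`, and
division by `E₁ E₂ = -ζ(s₁) E₂` yields `M₁ + M₂`. These steps are `evans_outerGraph`,
`fundamentalMatrix_innerGraph`, `evans_eq_neumannDet_add`, and the relations `outer_relation` and
`inner_relation`.

The rest relates this algebra to the operators. For `V ∈ L¹` the equation is a Volterra equation
whose iterates decay like `mⁿ/n!`; this gives existence, uniqueness and analyticity in `z`, so Evans
functions are entire. The boundary conditions describe exactly the ranges of `[-α₂*; α₁*]` and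
`[-β₂*; β₁*]`, so a kernel vector of the fundamental matrix is the same thing as a solution of the
homogeneous boundary value problem. If the Evans function vanishes there is an eigenfunction;
otherwise an inhomogeneous solution can be corrected to zero trace, which constructs a bounded
resolvent. Hence the resolvent set is where the Evans function is nonzero (`mem_resolventSet_iff`).
Potentials may be complex, so discreteness of the complement cannot rest on self-adjointness;
instead an energy estimate at `z = -r` with `r` large excludes eigenfunctions
(`exists_evans_ne_zero`), and the identity theorem applies. -/

lemma AbsolutelyContinuousOnInterval.of_dist_le {X Y : Type*} [PseudoMetricSpace X]
    [PseudoMetricSpace Y] {f : ℝ → X} {g : ℝ → Y} {a b : ℝ}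
    (hg : AbsolutelyContinuousOnInterval g a b)
    (h : ∀ x ∈ uIcc a b, ∀ y ∈ uIcc a b, dist (f x) (f y) ≤ dist (g x) (g y)) :
    AbsolutelyContinuousOnInterval f a b := by
  rw [absolutelyContinuousOnInterval_iff] at hg ⊢
  intro ε hε
  obtain ⟨δ, hδ, H⟩ := hg ε hε
  refine ⟨δ, hδ, fun E hE hs => (Finset.sum_le_sum fun i hi => ?_).trans_lt (H E hE hs)⟩
  exact h _ (hE.1 i hi).1 _ (hE.1 i hi).2

section

variable {F : Type*} [NormedAddCommGroup F] [NormedSpace ℝ F]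

/-- Increments of the primitive of `f` are dominated by those of the primitive of `‖f‖`, which
reduces the vector-valued case to the real one. -/
lemma IntervalIntegrable.absolutelyContinuousOnInterval_primitive {f : ℝ → F} {a b : ℝ}
    (h : IntervalIntegrable f volume a b) :
    AbsolutelyContinuousOnInterval (fun x => ∫ t in a..x, f t) a b := by
  refine (h.norm.absolutelyContinuousOnInterval_intervalIntegral
    left_mem_uIcc).of_dist_le fun x hx y hy => ?_
  have hi : ∀ z ∈ uIcc a b, IntervalIntegrable f volume a z := fun z hz =>
    h.mono_set (uIcc_subset_uIcc left_mem_uIcc hz)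
  rw [dist_eq_norm, dist_eq_norm, intervalIntegral.integral_interval_sub_left (hi x hx) (hi y hy),
    intervalIntegral.integral_interval_sub_left (hi x hx).norm (hi y hy).norm, Real.norm_eq_abs]
  exact intervalIntegral.norm_integral_le_abs_integral_norm

/-- The difference of `f` and the primitive of `f'` is absolutely continuous with derivative zero
almost everywhere, hence constant. -/
lemma AbsolutelyContinuousOnInterval.integral_eq_sub_of_ae_hasDerivAt [CompleteSpace F]
    {f f' : ℝ → F} {a b : ℝ}
    (hf : AbsolutelyContinuousOnInterval f a b) (hf' : IntervalIntegrable f' volume a b)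
    (hd : ∀ᵐ x, x ∈ uIcc a b → HasDerivAt f (f' x) x) :
    ∫ x in a..b, f' x = f b - f a := by
  obtain ⟨C, hC⟩ := (hf.sub hf'.absolutelyContinuousOnInterval_primitive).const_of_ae_hasDerivAt_zero
    (by
      filter_upwards [hd, hf'.ae_hasDerivAt_integral] with x h1 h2 hx
      simpa using! (h1 hx).sub (h2 hx a left_mem_uIcc))
  have ha := hC a left_mem_uIcc
  have hb := hC b right_mem_uIcc
  simp only [Pi.sub_apply, intervalIntegral.integral_same, sub_zero] at ha hb
  rw [ha, ← hb]
  abel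

end

/-- Integration by parts for functions that are only primitives of integrable functions, as `u'` is
for an `L¹` potential. It serves both the Wronskian and the energy identity. -/
lemma IntervalIntegrable.integral_primitive_mul {f f' g g' : ℝ → ℂ} {a b : ℝ} (hab : a ≤ b)
    (hf' : IntervalIntegrable f' volume a b) (hg' : IntervalIntegrable g' volume a b)
    (hf : ∀ x ∈ Icc a b, f x = f a + ∫ t in a..x, f' t)
    (hg : ∀ x ∈ Icc a b, g x = g a + ∫ t in a..x, g' t) :
    IntervalIntegrable (fun x => f' x * g x + f x * g' x) volume a b ∧
      ∫ x in a..b, (f' x * g x + f x * g' x) = f b * g b - f a * g a := by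
  have key : ∀ {h h' : ℝ → ℂ}, IntervalIntegrable h' volume a b →
      (∀ x ∈ Icc a b, h x = h a + ∫ t in a..x, h' t) →
      AbsolutelyContinuousOnInterval h a b ∧ ∀ᵐ x, x ∈ Ioo a b → HasDerivAt h (h' x) x := by
    intro h h' hi he
    constructor
    · refine hi.absolutelyContinuousOnInterval_primitive.of_dist_le fun x hx y hy => ?_
      rw [uIcc_of_le hab] at hx hy
      rw [he x hx, he y hy, dist_add_left]
    · filter_upwards [hi.ae_hasDerivAt_integral] with x hx hx'
      have h1 := (hx (by rw [uIcc_of_le hab]; exact Ioo_subset_Icc_self hx') a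
        left_mem_uIcc).const_add (h a)
      refine h1.congr_of_eventuallyEq ?_
      filter_upwards [isOpen_Ioo.mem_nhds hx'] with y hy using he y (Ioo_subset_Icc_self hy)
  obtain ⟨acf, df⟩ := key hf' hf
  obtain ⟨acg, dg⟩ := key hg' hg
  have hi : IntervalIntegrable (fun x => f' x * g x + f x * g' x) volume a b :=
    (hf'.mul_continuousOn acg.continuousOn).add (hg'.continuousOn_mul acf.continuousOn)
  refine ⟨hi, (acf.smul acg).integral_eq_sub_of_ae_hasDerivAt hi ?_⟩
  -- The representations of `f` and `g` hold on `[a,b]` only, so they determine two-sided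
  -- derivatives only in the interior; the end points are a null set.
  have h1 : ∀ᵐ x : ℝ, x ≠ a := by simp [ae_iff, measure_singleton]
  have h2 : ∀ᵐ x : ℝ, x ≠ b := by simp [ae_iff, measure_singleton]
  filter_upwards [df, dg, h1, h2] with x hx hy ha hb hxab
  rw [uIcc_of_le hab] at hxab
  have hm : x ∈ Ioo a b := ⟨lt_of_le_of_ne hxab.1 ha.symm, lt_of_le_of_ne hxab.2 hb⟩
  exact (hx hm).mul (hy hm)

/-- The integrand is the almost-everywhere derivative of `H ^ (n + 1) / (n + 1)`, `H` being the
primitive of `h`. Iterating this formula produces the factorials in the Volterra estimate. -/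
lemma IntervalIntegrable.integral_mul_primitive_pow {h : ℝ → ℝ} {a b : ℝ}
    (hh : IntervalIntegrable h volume a b) (n : ℕ) :
    IntervalIntegrable (fun x => h x * (∫ t in a..x, h t) ^ n) volume a b ∧
      ∫ x in a..b, h x * (∫ t in a..x, h t) ^ n = (∫ t in a..b, h t) ^ (n + 1) / (n + 1) := by
  have ac := hh.absolutelyContinuousOnInterval_primitive
  have acp : ∀ n : ℕ, AbsolutelyContinuousOnInterval (fun x => (∫ t in a..x, h t) ^ (n + 1)) a b := by
    intro n
    induction n with
    | zero => simpa using ac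
    | succ n ih => simpa [pow_succ] using! ih.mul ac
  have hi : IntervalIntegrable (fun x => h x * (∫ t in a..x, h t) ^ n) volume a b :=
    hh.mul_continuousOn (ac.continuousOn.pow n)
  refine ⟨hi, ?_⟩
  have := (acp n).integral_eq_sub_of_ae_hasDerivAt (hi.const_mul (n + 1)) (by
    filter_upwards [hh.ae_hasDerivAt_integral] with x hx hx'
    convert! (hx hx' a left_mem_uIcc).pow (n + 1) using 1
    push_cast
    ring)
  rw [intervalIntegral.integral_const_mul] at this
  simp only [intervalIntegral.integral_same, ne_eq, Nat.add_eq_zero_iff, one_ne_zero, and_false,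
    not_false_eq_true, zero_pow, sub_zero] at this
  rw [← this]
  field_simp

namespace QuantumStar

noncomputable section

/-! ### The Volterra operator of an edge -/

/-- `1 - x` is a factor of the invertible `1 - x ^ n`, and it commutes with the cofactor, a
geometric sum. -/
lemma isUnit_one_sub_of_norm_pow_lt_one {R : Type*} [NormedRing R] [HasSummableGeomSeries R]
    {x : R} {n : ℕ} (h : ‖x ^ n‖ < 1) : IsUnit (1 - x) := by
  have hu : IsUnit (1 - x ^ n) := isUnit_one_sub_of_norm_lt_one h
  rw [← mul_neg_geom_sum] at hu
  exact ((Commute.isUnit_mul_iff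
    ((mul_neg_geom_sum x n).trans (geom_sum_mul_neg x n).symm)).1 hu).1

lemma differentiable_inverse_sub_smul {R : Type*} [NormedRing R] [NormedAlgebra ℂ R]
    [HasSummableGeomSeries R] (A N : R) (h : ∀ z : ℂ, IsUnit (A - z • N)) :
    Differentiable ℂ fun z : ℂ => Ring.inverse (A - z • N) := by
  intro z
  have h1 : DifferentiableAt ℂ (fun z : ℂ => A - z • N) z :=
    (differentiableAt_const A).sub (differentiableAt_id.smul_const N)
  exact DifferentiableAt.comp z (differentiableAt_inverse (h z)) h1

section Volterra

variable {a b : ℝ}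

lemma intervalIntegrable_of_mem {E : Type*} [NormedAddCommGroup E] {q : ℝ → E}
    (hq : IntegrableOn q (Ioo a b)) {x : ℝ} (hx : x ∈ Icc a b) :
    IntervalIntegrable q volume a x := by
  rw [intervalIntegrable_iff_integrableOn_Ioo_of_le hx.1]
  exact hq.mono_set (Ioo_subset_Ioo_right hx.2)

lemma intervalIntegrable_mul_iccExtend (hab : a ≤ b) {q : ℝ → ℂ} (hq : IntegrableOn q (Ioo a b))
    (v : C(Icc a b, ℂ)) {x : ℝ} (hx : x ∈ Icc a b) :
    IntervalIntegrable (fun t => q t * IccExtend hab v t) volume a x :=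
  (intervalIntegrable_of_mem hq hx).mul_continuousOn (v.continuous.Icc_extend' (h := hab)).continuousOn

lemma continuous_primitive_mul_iccExtend (hab : a ≤ b) {q : ℝ → ℂ}
    (hq : IntegrableOn q (Ioo a b)) (v : C(Icc a b, ℂ)) :
    Continuous fun x : Icc a b => ∫ t in a..x, q t * IccExtend hab v t := by
  have h := intervalIntegral.continuousOn_primitive_interval'
    (intervalIntegrable_mul_iccExtend hab hq v (right_mem_Icc.2 hab)) left_mem_uIcc
  rw [uIcc_of_le hab] at h
  exact continuousOn_iff_continuous_domRestrict.1 h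

/-- The operator `v ↦ ∫_a^x q v` on `C([a,b])`. -/
def primitiveOp (hab : a ≤ b) (q : ℝ → ℂ) (hq : IntegrableOn q (Ioo a b)) :
    C(Icc a b, ℂ) →L[ℂ] C(Icc a b, ℂ) :=
  LinearMap.mkContinuous
    { toFun := fun v => ⟨fun x => ∫ t in a..x, q t * IccExtend hab v t,
        continuous_primitive_mul_iccExtend hab hq v⟩
      map_add' := fun v w => by
        ext x
        change (∫ t in a..x, q t * IccExtend hab (v + w) t) =
          (∫ t in a..x, q t * IccExtend hab v t) + ∫ t in a..x, q t * IccExtend hab w t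
        rw [← intervalIntegral.integral_add (intervalIntegrable_mul_iccExtend hab hq v x.2)
          (intervalIntegrable_mul_iccExtend hab hq w x.2)]
        simp [IccExtend, mul_add]
      map_smul' := fun c v => by
        ext x
        change (∫ t in a..x, q t * IccExtend hab (c • v) t) =
          c • ∫ t in a..x, q t * IccExtend hab v t
        rw [← intervalIntegral.integral_smul]
        simp [IccExtend, mul_left_comm c] }
    (∫ t in a..b, ‖q t‖) (fun v => by
      have hqb := (intervalIntegrable_of_mem hq (right_mem_Icc.2 hab)).norm
      rw [ContinuousMap.norm_le _ (mul_nonneg (intervalIntegral.integral_nonneg hab fun _ _ =>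
        norm_nonneg _) (norm_nonneg _))]
      intro x
      change ‖∫ t in a..x, q t * IccExtend hab v t‖ ≤ _
      rw [← intervalIntegral.integral_mul_const]
      calc ‖∫ t in a..x, q t * IccExtend hab v t‖
          ≤ ∫ t in a..x, ‖q t * IccExtend hab v t‖ :=
            intervalIntegral.norm_integral_le_integral_norm x.2.1
        _ ≤ ∫ t in a..x, ‖q t‖ * ‖v‖ := by
            refine intervalIntegral.integral_mono_on x.2.1
              (intervalIntegrable_mul_iccExtend hab hq v x.2).norm
              ((intervalIntegrable_of_mem hq x.2).norm.mul_const _) fun t _ => ?_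
            rw [norm_mul]
            gcongr
            exact v.norm_coe_le_norm _
        _ ≤ ∫ t in a..b, ‖q t‖ * ‖v‖ :=
            intervalIntegral.integral_mono_interval le_rfl x.2.1 x.2.2
              (Eventually.of_forall fun t => by positivity) (hqb.mul_const _))

lemma primitiveOp_apply (hab : a ≤ b) (q : ℝ → ℂ) (hq : IntegrableOn q (Ioo a b))
    (v : C(Icc a b, ℂ)) (x : Icc a b) :
    primitiveOp hab q hq v x = ∫ t in a..x, q t * IccExtend hab v t := rfl

lemma integrableOn_Ioo_const (c : ℂ) : IntegrableOn (fun _ => c) (Ioo a b) :=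
  integrableOn_const (by simp)

/-- The pairs `(u, u')` of continuous functions on `[a,b]`. -/
abbrev PhaseSpace (a b : ℝ) : Type := C(Icc a b, ℂ) × C(Icc a b, ℂ)

/-- The Volterra operator `(u, u') ↦ (∫ u', ∫ (V - z) u)`. -/
def volterraOp (hab : a ≤ b) (V : ℝ → ℂ) (hV : IntegrableOn V (Ioo a b)) (z : ℂ) :
    PhaseSpace a b →L[ℂ] PhaseSpace a b :=
  ((primitiveOp hab 1 (integrableOn_Ioo_const 1)).comp
      (ContinuousLinearMap.snd ℂ C(Icc a b, ℂ) C(Icc a b, ℂ))).prod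
    ((primitiveOp hab V hV - z • primitiveOp hab 1 (integrableOn_Ioo_const 1)).comp
      (ContinuousLinearMap.fst ℂ C(Icc a b, ℂ) C(Icc a b, ℂ)))

lemma volterraOp_fst (hab : a ≤ b) (V : ℝ → ℂ) (hV : IntegrableOn V (Ioo a b)) (z : ℂ)
    (w : PhaseSpace a b) (x : Icc a b) :
    (volterraOp hab V hV z w).1 x = ∫ t in a..x, IccExtend hab w.2 t := by
  simp [volterraOp, primitiveOp_apply]

lemma volterraOp_snd (hab : a ≤ b) (V : ℝ → ℂ) (hV : IntegrableOn V (Ioo a b)) (z : ℂ)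
    (w : PhaseSpace a b) (x : Icc a b) :
    (volterraOp hab V hV z w).2 x = ∫ t in a..x, (V t - z) * IccExtend hab w.1 t := by
  have h1 := intervalIntegrable_mul_iccExtend hab hV w.1 x.2
  have h2 := intervalIntegrable_mul_iccExtend hab (integrableOn_Ioo_const (a := a) (b := b) z) w.1 x.2
  simp only [sub_mul]
  rw [intervalIntegral.integral_sub h1 h2, intervalIntegral.integral_const_mul]
  simp [volterraOp, primitiveOp_apply]

/-- The weight `1 + ‖V - z‖` dominates both kernels, `1` and `V - z`, so each application of the
operator integrates the previous bound against the weight. The bound is kept pointwise in `x`, since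
the induction integrates it up to `x`. -/
lemma norm_volterraOp_pow_le (hab : a ≤ b) (V : ℝ → ℂ) (hV : IntegrableOn V (Ioo a b)) (z : ℂ)
    (w : PhaseSpace a b) (n : ℕ) (x : Icc a b) :
    ‖((volterraOp hab V hV z ^ n) w).1 x‖ ≤
        (∫ t in a..x, (1 + ‖V t - z‖)) ^ n / n.factorial * ‖w‖ ∧
      ‖((volterraOp hab V hV z ^ n) w).2 x‖ ≤
        (∫ t in a..x, (1 + ‖V t - z‖)) ^ n / n.factorial * ‖w‖ := by
  induction n generalizing x with
  | zero =>
    simp only [pow_zero, Nat.factorial_zero, Nat.cast_one, div_one, one_mul]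
    exact ⟨(w.1.norm_coe_le_norm x).trans (norm_fst_le w),
      (w.2.norm_coe_le_norm x).trans (norm_snd_le w)⟩
  | succ n ih =>
    set K := volterraOp hab V hV z
    set h : ℝ → ℝ := fun t => 1 + ‖V t - z‖ with hh
    set y := (K ^ n) w
    have hVz : IntegrableOn (fun t => V t - z) (Ioo a b) := hV.sub (integrableOn_Ioo_const z)
    have hhi : IntegrableOn h (Ioo a b) := (integrableOn_const (by simp)).add hVz.norm
    have hx := intervalIntegrable_of_mem hhi x.2
    obtain ⟨hi, he⟩ := hx.integral_mul_primitive_pow n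
    have hbound : ∫ t in a..x, h t * ((∫ s in a..t, h s) ^ n / n.factorial * ‖w‖) =
        (∫ t in a..x, h t) ^ (n + 1) / (n + 1).factorial * ‖w‖ := by
      have h1 : (fun t => h t * ((∫ s in a..t, h s) ^ n / n.factorial * ‖w‖)) =
          fun t => h t * (∫ s in a..t, h s) ^ n * (‖w‖ / n.factorial) := by
        ext t; ring
      rw [h1, intervalIntegral.integral_mul_const, he, Nat.factorial_succ]
      push_cast
      field_simp
    have hib : IntervalIntegrable
        (fun t => h t * ((∫ s in a..t, h s) ^ n / n.factorial * ‖w‖)) volume a x := by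
      have h1 : (fun t => h t * ((∫ s in a..t, h s) ^ n / n.factorial * ‖w‖)) =
          fun t => h t * (∫ s in a..t, h s) ^ n * (‖w‖ / n.factorial) := by
        ext t; ring
      rw [h1]
      exact hi.mul_const _
    have hmem : ∀ t ∈ Icc a (x : ℝ), t ∈ Icc a b := fun t ht => ⟨ht.1, ht.2.trans x.2.2⟩
    have hnn : ∀ t ∈ Icc a (x : ℝ), 0 ≤ (∫ s in a..t, h s) ^ n / n.factorial * ‖w‖ := by
      intro t ht
      have : 0 ≤ ∫ s in a..t, h s := intervalIntegral.integral_nonneg ht.1 fun s _ => by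
        simp only [hh]; positivity
      positivity
    have hy : (K ^ (n + 1)) w = K y := by rw [pow_succ']; rfl
    rw [hy, ← hbound]
    constructor
    · rw [volterraOp_fst]
      refine (intervalIntegral.norm_integral_le_integral_norm x.2.1).trans
        (intervalIntegral.integral_mono_on x.2.1
          ((y.2.continuous.Icc_extend' (h := hab)).norm.intervalIntegrable _ _) hib fun t ht => ?_)
      rw [IccExtend_of_mem _ _ (hmem t ht)]
      refine ((ih ⟨t, hmem t ht⟩).2).trans (le_mul_of_one_le_left (hnn t ht) ?_)
      simp only [hh]
      linarith [norm_nonneg (V t - z)]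
    · rw [volterraOp_snd]
      refine (intervalIntegral.norm_integral_le_integral_norm x.2.1).trans
        (intervalIntegral.integral_mono_on x.2.1
          (intervalIntegrable_mul_iccExtend hab hVz y.1 x.2).norm hib fun t ht => ?_)
      rw [IccExtend_of_mem _ _ (hmem t ht), norm_mul]
      refine mul_le_mul ?_ (ih ⟨t, hmem t ht⟩).1 (norm_nonneg _) (by simp only [hh]; positivity)
      simp only [hh]
      linarith

lemma isUnit_one_sub_volterraOp (hab : a ≤ b) (V : ℝ → ℂ) (hV : IntegrableOn V (Ioo a b)) (z : ℂ) :
    IsUnit (1 - volterraOp hab V hV z) := by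
  set K := volterraOp hab V hV z
  set m := ∫ t in a..b, (1 + ‖V t - z‖)
  have hi : IntegrableOn (fun t => 1 + ‖V t - z‖) (Ioo a b) :=
    (integrableOn_const (by simp)).add (hV.sub (integrableOn_Ioo_const z)).norm
  have hm : 0 ≤ m := intervalIntegral.integral_nonneg hab fun t _ => by positivity
  have hK : ∀ n, ‖K ^ n‖ ≤ m ^ n / n.factorial := by
    intro n
    refine ContinuousLinearMap.opNorm_le_bound _ (by positivity) fun w => ?_
    have hle : ∀ x : Icc a b, (∫ t in a..x, (1 + ‖V t - z‖)) ^ n / n.factorial * ‖w‖ ≤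
        m ^ n / n.factorial * ‖w‖ := by
      intro x
      have h0 : 0 ≤ ∫ t in a..x, (1 + ‖V t - z‖) :=
        intervalIntegral.integral_nonneg x.2.1 fun t _ => by positivity
      have h1 : ∫ t in a..x, (1 + ‖V t - z‖) ≤ m :=
        intervalIntegral.integral_mono_interval le_rfl x.2.1 x.2.2
          (Eventually.of_forall fun t => by positivity)
          (intervalIntegrable_of_mem hi (right_mem_Icc.2 hab))
      gcongr
    rw [Prod.norm_def]
    refine max_le ?_ ?_ <;> rw [ContinuousMap.norm_le _ (by positivity)] <;> intro x
    · exact (norm_volterraOp_pow_le hab V hV z w n x).1.trans (hle x)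
    · exact (norm_volterraOp_pow_le hab V hV z w n x).2.trans (hle x)
  -- The operator itself need not be a contraction, but `mⁿ/n!` tends to zero, so some power is.
  obtain ⟨n, hn⟩ := ((FloorSemiring.tendsto_pow_div_factorial_atTop m).eventually
    (gt_mem_nhds one_pos)).exists
  exact isUnit_one_sub_of_norm_pow_lt_one (R := PhaseSpace a b →L[ℂ] PhaseSpace a b)
    ((hK n).trans_lt hn)

/-- The inverse of `1 - volterraOp`. -/
def solutionOp (hab : a ≤ b) (V : ℝ → ℂ) (hV : IntegrableOn V (Ioo a b)) (z : ℂ) :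
    PhaseSpace a b →L[ℂ] PhaseSpace a b :=
  Ring.inverse (1 - volterraOp hab V hV z)

lemma solutionOp_apply (hab : a ≤ b) (V : ℝ → ℂ) (hV : IntegrableOn V (Ioo a b)) (z : ℂ)
    (w : PhaseSpace a b) :
    solutionOp hab V hV z w = w + volterraOp hab V hV z (solutionOp hab V hV z w) := by
  have h := Ring.mul_inverse_cancel _ (isUnit_one_sub_volterraOp hab V hV z)
  have h' := congrArg (fun T : PhaseSpace a b →L[ℂ] PhaseSpace a b => T w) h
  simp only [mul_apply_eq_comp, sub_apply,
    one_apply_eq_self] at h'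
  exact eq_add_of_sub_eq h'

lemma eq_zero_of_eq_volterraOp (hab : a ≤ b) (V : ℝ → ℂ) (hV : IntegrableOn V (Ioo a b)) (z : ℂ)
    {w : PhaseSpace a b} (h : w = volterraOp hab V hV z w) : w = 0 := by
  have h1 := Ring.inverse_mul_cancel _ (isUnit_one_sub_volterraOp hab V hV z)
  have h' := congrArg (fun T : PhaseSpace a b →L[ℂ] PhaseSpace a b => T w) h1
  simp only [mul_apply_eq_comp, sub_apply,
    one_apply_eq_self] at h'
  rw [← h', sub_eq_zero.2 h, map_zero]

lemma differentiable_solutionOp (hab : a ≤ b) (V : ℝ → ℂ) (hV : IntegrableOn V (Ioo a b)) :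
    Differentiable ℂ (solutionOp hab V hV) := by
  -- `N` is the coefficient of `z` in the Volterra operator, which is affine in `z`; the solution
  -- operator is thus the inverse of an affine pencil.
  set N : PhaseSpace a b →L[ℂ] PhaseSpace a b :=
    (0 : PhaseSpace a b →L[ℂ] C(Icc a b, ℂ)).prod
      (-(primitiveOp hab 1 (integrableOn_Ioo_const 1)).comp
        (ContinuousLinearMap.fst ℂ C(Icc a b, ℂ) C(Icc a b, ℂ))) with hN
  have h2 : ∀ z, 1 - volterraOp hab V hV z = (1 - volterraOp hab V hV 0) - z • N := by
    intro z
    refine ContinuousLinearMap.ext fun w => Prod.ext ?_ ?_ <;> ext x <;> simp [volterraOp, hN]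
    ring
  have h3 : solutionOp hab V hV = fun z => Ring.inverse ((1 - volterraOp hab V hV 0) - z • N) := by
    ext1 z
    rw [← h2 z]
    rfl
  rw [h3]
  exact differentiable_inverse_sub_smul (R := PhaseSpace a b →L[ℂ] PhaseSpace a b) _ _
    fun z => h2 z ▸ isUnit_one_sub_volterraOp hab V hV z

end Volterra

end

noncomputable section

/-! ### Sobolev functions and initial value problems on an edge -/

section Edge

variable {a b : ℝ} {u u' u'' v v' : ℝ → ℂ} {V : ℝ → ℂ} {z : ℂ}

lemma IsW21.continuousOn (h : IsW21 a b u u' u'') : ContinuousOn u (Icc a b) :=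
  fun x hx => (h.hasDeriv x hx).continuousWithinAt

lemma IsW21.continuousOn_deriv (h : IsW21 a b u u' u'') : ContinuousOn u' (Icc a b) := by
  rcases lt_or_ge b a with hab | hab
  · simp [Icc_eq_empty_of_lt hab]
  have h1 := intervalIntegral.continuousOn_primitive_interval'
    (h.intervalIntegrable (right_mem_Icc.2 hab)) left_mem_uIcc
  rw [uIcc_of_le hab] at h1
  exact (continuousOn_const.add h1).congr h.integral_eq

lemma IsW21.eq_add_integral_deriv (h : IsW21 a b u u' u'') {x : ℝ} (hx : x ∈ Icc a b) :
    u x = u a + ∫ t in a..x, u' t := by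
  have hsub : Icc a x ⊆ Icc a b := Icc_subset_Icc_right hx.2
  rw [intervalIntegral.integral_eq_sub_of_hasDerivAt_of_le hx.1 (h.continuousOn.mono hsub)
    (fun t ht => (h.hasDeriv t (hsub (Ioo_subset_Icc_self ht))).hasDerivAt
      (Icc_mem_nhds ht.1 (ht.2.trans_le hx.2)))
    ((h.continuousOn_deriv.mono (by rwa [uIcc_of_le hx.1])).intervalIntegrable)]
  ring

lemma IsW21.congr_second {w'' : ℝ → ℂ} (h : IsW21 a b u u' u'') (e : EqOn u'' w'' (Ioo a b)) :
    IsW21 a b u u' w'' where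
  integrableOn := h.integrableOn.congr_fun e measurableSet_Ioo
  hasDeriv := h.hasDeriv
  integral_eq x hx := by
    rw [h.integral_eq x hx]
    congr 1
    rw [intervalIntegral.integral_of_le hx.1, intervalIntegral.integral_of_le hx.1,
      integral_Ioc_eq_integral_Ioo, integral_Ioc_eq_integral_Ioo]
    exact setIntegral_congr_fun measurableSet_Ioo fun t ht => e (Ioo_subset_Ioo_right hx.2 ht)

lemma IsW21.restrict {c d : ℝ} (h : IsW21 a b u u' u'') (hc : c ∈ Icc a b) (hd : d ≤ b) :
    IsW21 c d u u' u'' where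
  integrableOn := h.integrableOn.mono_set (Ioo_subset_Ioo hc.1 hd)
  hasDeriv x hx := (h.hasDeriv x ⟨hc.1.trans hx.1, hx.2.trans hd⟩).mono (Icc_subset_Icc hc.1 hd)
  integral_eq x hx := by
    have hx' : x ∈ Icc a b := ⟨hc.1.trans hx.1, hx.2.trans hd⟩
    rw [h.integral_eq x hx', h.integral_eq c hc, ← intervalIntegral.integral_add_adjacent_intervals
      (h.intervalIntegrable hc) ((h.intervalIntegrable hc).symm.trans (h.intervalIntegrable hx')),
      add_assoc]

lemma IsEdgeSolution.add (h : IsEdgeSolution V z a b u u') (k : IsEdgeSolution V z a b v v') :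
    IsEdgeSolution V z a b (u + v) (u' + v') :=
  (IsW21.add h k).congr_second fun x _ => by simp only [Pi.add_apply]; ring

lemma IsEdgeSolution.smul (c : ℂ) (h : IsEdgeSolution V z a b u u') :
    IsEdgeSolution V z a b (c • u) (c • u') :=
  (IsW21.smul c h).congr_second fun x _ => by simp only [Pi.smul_apply, smul_eq_mul]; ring

lemma IsEdgeSolution.zero : IsEdgeSolution V z a b 0 0 :=
  (IsW21.zero a b).congr_second fun x _ => by simp

lemma IsEdgeSolution.sub (h : IsEdgeSolution V z a b u u') (k : IsEdgeSolution V z a b v v') :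
    IsEdgeSolution V z a b (u - v) (u' - v') := by
  have := h.add (k.smul (-1))
  rwa [neg_one_smul, neg_one_smul, ← sub_eq_add_neg, ← sub_eq_add_neg] at this

lemma IsEdgeSolution.sum {κ : Type*} (s : Finset κ) {w w' : κ → ℝ → ℂ}
    (h : ∀ i ∈ s, IsEdgeSolution V z a b (w i) (w' i)) :
    IsEdgeSolution V z a b (∑ i ∈ s, w i) (∑ i ∈ s, w' i) := by
  classical
  induction s using Finset.induction_on with
  | empty => simpa using IsEdgeSolution.zero
  | insert i s hi ih =>
    rw [Finset.sum_insert hi, Finset.sum_insert hi]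
    exact (h i (by simp)).add (ih fun j hj => h j (by simp [hj]))

/-- A function of class `W^{2,1}` with vanishing data at the left end point that solves the
homogeneous equation vanishes. -/
lemma IsEdgeSolution.eq_zero_of_left (hab : a ≤ b) (hV : IntegrableOn V (Ioo a b))
    (h : IsEdgeSolution V z a b u u') (h0 : u a = 0) (h1 : u' a = 0) :
    ∀ x ∈ Icc a b, u x = 0 ∧ u' x = 0 := by
  let w : PhaseSpace a b := (⟨fun x => u x, continuousOn_iff_continuous_domRestrict.1 h.continuousOn⟩,
    ⟨fun x => u' x, continuousOn_iff_continuous_domRestrict.1 h.continuousOn_deriv⟩)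
  have e1 : ∀ t ∈ Icc a b, IccExtend hab w.1 t = u t := fun t ht => by
    rw [IccExtend_of_mem _ _ ht]; rfl
  have e2 : ∀ t ∈ Icc a b, IccExtend hab w.2 t = u' t := fun t ht => by
    rw [IccExtend_of_mem _ _ ht]; rfl
  have hsub : ∀ x : Icc a b, uIcc a (x : ℝ) ⊆ Icc a b := fun x => by
    rw [uIcc_of_le x.2.1]; exact Icc_subset_Icc_right x.2.2
  have hw : w = volterraOp hab V hV z w := by
    refine Prod.ext ?_ ?_ <;> ext x
    · rw [volterraOp_fst, intervalIntegral.integral_congr fun t ht => e2 t (hsub x ht)]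
      have := h.eq_add_integral_deriv x.2
      rw [h0, zero_add] at this
      exact this
    · rw [volterraOp_snd]
      have := h.integral_eq x x.2
      rw [h1, zero_add] at this
      refine Eq.trans this (intervalIntegral.integral_congr fun t ht => ?_)
      simp only [e1 t (hsub x ht)]
  have hz := eq_zero_of_eq_volterraOp hab V hV z hw
  intro x hx
  exact ⟨(e1 x hx).symm.trans (by simp [hz, IccExtend]), (e2 x hx).symm.trans (by simp [hz, IccExtend])⟩

lemma IsEdgeSolution.eq_of_left (hab : a ≤ b) (hV : IntegrableOn V (Ioo a b))
    (h : IsEdgeSolution V z a b u u') (k : IsEdgeSolution V z a b v v')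
    (h0 : u a = v a) (h1 : u' a = v' a) :
    ∀ x ∈ Icc a b, u x = v x ∧ u' x = v' x := fun x hx => by
  have := (h.sub k).eq_zero_of_left hab hV (by simp [h0]) (by simp [h1]) x hx
  simpa [sub_eq_zero] using this

/-- The Wronskian of two solutions is constant. -/
lemma IsEdgeSolution.wronskian (h : IsEdgeSolution V z a b u u')
    (k : IsEdgeSolution V z a b v v') {x : ℝ} (hx : x ∈ Icc a b) :
    u x * v' x - v x * u' x = u a * v' a - v a * u' a := by
  have hsub : ∀ t ∈ Icc a x, t ∈ Icc a b := fun t ht => ⟨ht.1, ht.2.trans hx.2⟩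
  have aux : ∀ {f f' g g' : ℝ → ℂ}, IsEdgeSolution V z a b f f' → IsEdgeSolution V z a b g g' →
      IntervalIntegrable (fun t => f' t * g' t + f t * ((V t - z) * g t)) volume a x ∧
      ∫ t in a..x, (f' t * g' t + f t * ((V t - z) * g t)) = f x * g' x - f a * g' a := by
    intro f f' g g' hf hg
    refine IntervalIntegrable.integral_primitive_mul hx.1
      (hf.continuousOn_deriv.mono ?_).intervalIntegrable (hg.intervalIntegrable hx)
      (fun t ht => hf.eq_add_integral_deriv (hsub t ht)) (fun t ht => hg.integral_eq t (hsub t ht))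
    rw [uIcc_of_le hx.1]
    exact hsub
  obtain ⟨-, e1⟩ := aux h k
  obtain ⟨-, e2⟩ := aux k h
  have e3 : ∫ t in a..x, (u' t * v' t + u t * ((V t - z) * v t)) =
      ∫ t in a..x, (v' t * u' t + v t * ((V t - z) * u t)) := by
    congr 1
    ext t
    ring
  rw [e1, e2] at e3
  linear_combination e3

/-- Solving the Volterra equation with the inhomogeneity `(c, d - ∫ f)` solves the initial value
problem `-u'' + (V - z) u = f`, `u a = c`, `u' a = d`. -/
lemma isW21_solutionOp (hab : a < b) (hV : IntegrableOn V (Ioo a b)) (z c d : ℂ) {f : ℝ → ℂ}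
    (hf : IntegrableOn f (Ioo a b)) (w : PhaseSpace a b)
    (hw : w = solutionOp hab.le V hV z (ContinuousMap.const _ c,
      ContinuousMap.const _ d - primitiveOp hab.le f hf 1)) :
    IsW21 a b (IccExtend hab.le w.1) (IccExtend hab.le w.2)
        (fun x => (V x - z) * IccExtend hab.le w.1 x - f x) ∧
      IccExtend hab.le w.1 a = c ∧ IccExtend hab.le w.2 a = d := by
  have key := solutionOp_apply hab.le V hV z (ContinuousMap.const _ c,
      ContinuousMap.const _ d - primitiveOp hab.le f hf 1)
  rw [← hw] at key
  have hVz : IntegrableOn (fun t => V t - z) (Ioo a b) := hV.sub (integrableOn_Ioo_const z)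
  have c1 : Continuous (IccExtend hab.le w.1) := w.1.continuous.Icc_extend' (h := hab.le)
  have c2 : Continuous (IccExtend hab.le w.2) := w.2.continuous.Icc_extend' (h := hab.le)
  have hint : ∀ x ∈ Icc a b, IntervalIntegrable (fun t => (V t - z) * IccExtend hab.le w.1 t)
      volume a x := fun x hx => intervalIntegrable_mul_iccExtend hab.le hVz w.1 hx
  have k1 : ∀ x ∈ Icc a b, IccExtend hab.le w.1 x = c + ∫ t in a..x, IccExtend hab.le w.2 t := by
    intro x hx
    have := congrArg (fun y : PhaseSpace a b => y.1 ⟨x, hx⟩) key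
    simp only [Prod.fst_add, ContinuousMap.add_apply, volterraOp_fst] at this
    rw [IccExtend_of_mem _ _ hx, this]
    rfl
  have k2 : ∀ x ∈ Icc a b, IccExtend hab.le w.2 x =
      d + ∫ t in a..x, ((V t - z) * IccExtend hab.le w.1 t - f t) := by
    intro x hx
    have := congrArg (fun y : PhaseSpace a b => y.2 ⟨x, hx⟩) key
    simp only [Prod.snd_add, ContinuousMap.add_apply, volterraOp_snd, ContinuousMap.sub_apply,
      ContinuousMap.const_apply, primitiveOp_apply] at this
    rw [IccExtend_of_mem _ _ hx, this, intervalIntegral.integral_sub (hint x hx)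
      (intervalIntegrable_of_mem hf hx)]
    simp [IccExtend]
    ring
  have ha : a ∈ Icc a b := left_mem_Icc.2 hab.le
  have a1 : IccExtend hab.le w.1 a = c := by simpa using k1 a ha
  have a2 : IccExtend hab.le w.2 a = d := by simpa using k2 a ha
  refine ⟨⟨?_, fun x hx => ?_, fun x hx => ?_⟩, a1, a2⟩
  · refine IntegrableOn.sub ?_ hf
    have := hint b (right_mem_Icc.2 hab.le)
    rwa [intervalIntegrable_iff_integrableOn_Ioo_of_le hab.le] at this
  · have hd : HasDerivAt (fun y => c + ∫ t in a..y, IccExtend hab.le w.2 t)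
        (IccExtend hab.le w.2 x) x :=
      (intervalIntegral.integral_hasDerivAt_right (c2.intervalIntegrable _ _)
        c2.stronglyMeasurable.stronglyMeasurableAtFilter c2.continuousAt).const_add c
    exact hd.hasDerivWithinAt.congr k1 (k1 x hx)
  · rw [a2, k2 x hx]

lemma exists_ivpSolution_left (hab : a < b) (hV : IntegrableOn V (Ioo a b)) (z c d : ℂ) :
    ∃ w, IsIVPSolution V z a b a c d w := by
  obtain ⟨h, h1, h2⟩ := isW21_solutionOp hab hV z c d (integrableOn_Ioo_const 0) _ rfl
  exact ⟨(_, _), h.congr_second fun x _ => sub_zero _, h1, h2⟩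

lemma isIVPSolution_of_exists {x₀ : ℝ} {c d : ℂ} (h : ∃ w, IsIVPSolution V z a b x₀ c d w) :
    IsIVPSolution V z a b x₀ c d (ivpSolution V z a b x₀ c d) := by
  rw [ivpSolution, dif_pos h]
  exact h.choose_spec

lemma isIVPSolution_left (hab : a < b) (hV : IntegrableOn V (Ioo a b)) (z c d : ℂ) :
    IsIVPSolution V z a b a c d (ivpSolution V z a b a c d) :=
  isIVPSolution_of_exists (exists_ivpSolution_left hab hV z c d)

/-- The solution of the initial value problem depends analytically on the spectral parameter. -/
lemma differentiable_ivpSolution_left (hab : a < b) (hV : IntegrableOn V (Ioo a b)) (c d : ℂ)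
    {x : ℝ} (hx : x ∈ Icc a b) :
    Differentiable ℂ (fun z => (ivpSolution V z a b a c d).1 x) ∧
      Differentiable ℂ (fun z => (ivpSolution V z a b a c d).2 x) := by
  set y : PhaseSpace a b := (ContinuousMap.const _ c,
    ContinuousMap.const _ d - primitiveOp hab.le (fun _ => (0 : ℂ)) (integrableOn_Ioo_const 0) 1)
  have hD : Differentiable ℂ fun z => solutionOp hab.le V hV z y :=
    (differentiable_solutionOp hab.le V hV).clm_apply (differentiable_const y)
  have he : ∀ z, (ivpSolution V z a b a c d).1 x = (solutionOp hab.le V hV z y).1 ⟨x, hx⟩ ∧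
      (ivpSolution V z a b a c d).2 x = (solutionOp hab.le V hV z y).2 ⟨x, hx⟩ := by
    intro z
    obtain ⟨h, h1, h2⟩ := isW21_solutionOp hab hV z c d (integrableOn_Ioo_const 0)
      (solutionOp hab.le V hV z y) rfl
    obtain ⟨k, k1, k2⟩ := isIVPSolution_left hab hV z c d
    have h' : IsEdgeSolution V z a b (IccExtend hab.le (solutionOp hab.le V hV z y).1)
      (IccExtend hab.le (solutionOp hab.le V hV z y).2) :=
      h.congr_second fun x _ => sub_zero _
    have := k.eq_of_left hab.le hV h' (k1.trans h1.symm) (k2.trans h2.symm) x hx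
    rwa [IccExtend_of_mem _ _ hx, IccExtend_of_mem _ _ hx] at this
  simp only [he]
  exact ⟨(((ContinuousMap.evalCLM ℂ (⟨x, hx⟩ : Icc a b)).comp
      (ContinuousLinearMap.fst ℂ C(Icc a b, ℂ) C(Icc a b, ℂ))).differentiable.comp hD),
    (((ContinuousMap.evalCLM ℂ (⟨x, hx⟩ : Icc a b)).comp
      (ContinuousLinearMap.snd ℂ C(Icc a b, ℂ) C(Icc a b, ℂ))).differentiable.comp hD)⟩

end Edge

end

noncomputable section

/-! ### Initial value problems at an arbitrary point of an edge -/

section Edge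

variable {a b : ℝ} {u u' v v' : ℝ → ℂ} {V : ℝ → ℂ} {z : ℂ}

/-- The value at `x` of a solution in terms of its data at the left end point. -/
lemma IsEdgeSolution.eq_combination (hab : a < b) (hV : IntegrableOn V (Ioo a b))
    (h : IsEdgeSolution V z a b u u') {x : ℝ} (hx : x ∈ Icc a b) :
    u x = (ivpSolution V z a b a 1 0).1 x * u a + (ivpSolution V z a b a 0 1).1 x * u' a ∧
      u' x = (ivpSolution V z a b a 1 0).2 x * u a + (ivpSolution V z a b a 0 1).2 x * u' a := by
  obtain ⟨k, k1, k2⟩ := isIVPSolution_left hab hV z 1 0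
  obtain ⟨l, l1, l2⟩ := isIVPSolution_left hab hV z 0 1
  have := h.eq_of_left hab.le hV ((k.smul (u a)).add (l.smul (u' a))) (by simp [k1, l1])
    (by simp [k2, l2]) x hx
  simpa [mul_comm] using this

lemma ivpSolution_wronskian (hab : a < b) (hV : IntegrableOn V (Ioo a b)) (z : ℂ) {x : ℝ}
    (hx : x ∈ Icc a b) :
    (ivpSolution V z a b a 1 0).1 x * (ivpSolution V z a b a 0 1).2 x -
      (ivpSolution V z a b a 0 1).1 x * (ivpSolution V z a b a 1 0).2 x = 1 := by
  obtain ⟨k, k1, k2⟩ := isIVPSolution_left hab hV z 1 0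
  obtain ⟨l, l1, l2⟩ := isIVPSolution_left hab hV z 0 1
  rw [k.wronskian l hx, k1, k2, l1, l2]
  ring

lemma IsEdgeSolution.eq_zero_of_point (hab : a < b) (hV : IntegrableOn V (Ioo a b))
    (h : IsEdgeSolution V z a b u u') {x₀ : ℝ} (hx₀ : x₀ ∈ Icc a b) (h0 : u x₀ = 0)
    (h1 : u' x₀ = 0) : ∀ x ∈ Icc a b, u x = 0 ∧ u' x = 0 := by
  obtain ⟨e1, e2⟩ := h.eq_combination hab hV hx₀
  have hw := ivpSolution_wronskian hab hV z hx₀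
  rw [h0] at e1
  rw [h1] at e2
  refine h.eq_zero_of_left hab.le hV ?_ ?_
  · linear_combination (-(ivpSolution V z a b a 0 1).2 x₀) * e1 +
      (ivpSolution V z a b a 0 1).1 x₀ * e2 - u a * hw
  · linear_combination ((ivpSolution V z a b a 1 0).2 x₀) * e1 -
      (ivpSolution V z a b a 1 0).1 x₀ * e2 - u' a * hw

lemma IsEdgeSolution.eq_of_point (hab : a < b) (hV : IntegrableOn V (Ioo a b))
    (h : IsEdgeSolution V z a b u u') (k : IsEdgeSolution V z a b v v') {x₀ : ℝ}
    (hx₀ : x₀ ∈ Icc a b) (h0 : u x₀ = v x₀) (h1 : u' x₀ = v' x₀) :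
    ∀ x ∈ Icc a b, u x = v x ∧ u' x = v' x := fun x hx => by
  have := (h.sub k).eq_zero_of_point hab hV hx₀ (by simp [h0]) (by simp [h1]) x hx
  simpa [sub_eq_zero] using this

/-- Initial value problems at an arbitrary point, in terms of those at the left end point. -/
lemma isIVPSolution_transfer (hab : a < b) (hV : IntegrableOn V (Ioo a b)) (z c d : ℂ) {x₀ : ℝ}
    (hx₀ : x₀ ∈ Icc a b) :
    IsIVPSolution V z a b x₀ c d
      (((ivpSolution V z a b a 0 1).2 x₀ * c - (ivpSolution V z a b a 0 1).1 x₀ * d) •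
          ivpSolution V z a b a 1 0 +
        ((ivpSolution V z a b a 1 0).1 x₀ * d - (ivpSolution V z a b a 1 0).2 x₀ * c) •
          ivpSolution V z a b a 0 1) := by
  obtain ⟨k, k1, k2⟩ := isIVPSolution_left hab hV z 1 0
  obtain ⟨l, l1, l2⟩ := isIVPSolution_left hab hV z 0 1
  have hw := ivpSolution_wronskian hab hV z hx₀
  refine ⟨(k.smul _).add (l.smul _), ?_, ?_⟩
  · simp only [Prod.fst_add, Prod.smul_fst, Pi.add_apply, Pi.smul_apply, smul_eq_mul]
    linear_combination c * hw
  · simp only [Prod.snd_add, Prod.smul_snd, Pi.add_apply, Pi.smul_apply, smul_eq_mul]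
    linear_combination d * hw

/-- A solution always exists, so the default value `0` in `ivpSolution` never occurs on a
non-degenerate edge. -/
lemma isIVPSolution_ivpSolution (hab : a < b) (hV : IntegrableOn V (Ioo a b)) (z c d : ℂ) {x₀ : ℝ}
    (hx₀ : x₀ ∈ Icc a b) : IsIVPSolution V z a b x₀ c d (ivpSolution V z a b x₀ c d) :=
  isIVPSolution_of_exists ⟨_, isIVPSolution_transfer hab hV z c d hx₀⟩

lemma IsIVPSolution.eq_of_eq (hab : a < b) (hV : IntegrableOn V (Ioo a b)) {c d : ℂ} {x₀ : ℝ}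
    (hx₀ : x₀ ∈ Icc a b) {w y : (ℝ → ℂ) × (ℝ → ℂ)} (hw : IsIVPSolution V z a b x₀ c d w)
    (hy : IsIVPSolution V z a b x₀ c d y) : ∀ x ∈ Icc a b, w.1 x = y.1 x ∧ w.2 x = y.2 x :=
  hw.1.eq_of_point hab hV hy.1 hx₀ (hw.2.1.trans hy.2.1.symm) (hw.2.2.trans hy.2.2.symm)

lemma differentiable_ivpSolution (hab : a < b) (hV : IntegrableOn V (Ioo a b)) (c d : ℂ)
    {x₀ x : ℝ} (hx₀ : x₀ ∈ Icc a b) (hx : x ∈ Icc a b) :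
    Differentiable ℂ (fun z => (ivpSolution V z a b x₀ c d).1 x) ∧
      Differentiable ℂ (fun z => (ivpSolution V z a b x₀ c d).2 x) := by
  obtain ⟨d1, d2⟩ := differentiable_ivpSolution_left hab hV 1 0 hx
  obtain ⟨d3, d4⟩ := differentiable_ivpSolution_left hab hV 0 1 hx
  obtain ⟨d5, d6⟩ := differentiable_ivpSolution_left hab hV 1 0 hx₀
  obtain ⟨d7, d8⟩ := differentiable_ivpSolution_left hab hV 0 1 hx₀
  have he := fun z => (isIVPSolution_ivpSolution hab hV z c d hx₀).eq_of_eq hab hV hx₀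
    (isIVPSolution_transfer hab hV z c d hx₀) x hx
  simp only [he, Prod.fst_add, Prod.smul_fst, Pi.add_apply, Pi.smul_apply, smul_eq_mul,
    Prod.snd_add, Prod.smul_snd]
  constructor <;> fun_prop

end Edge

/-! ### Self-adjoint boundary matrices -/

section Matrices

open Matrix

variable {ι : Type} [Fintype ι] {A B : Matrix ι ι ℂ}

lemma mulVec_neg_conjTranspose_add (hAB : A * Bᴴ = B * Aᴴ) (c : ι → ℂ) :
    A.mulVec ((-Bᴴ).mulVec c) + B.mulVec (Aᴴ.mulVec c) = 0 := by
  rw [mulVec_mulVec, mulVec_mulVec, mul_neg, hAB, neg_mulVec, neg_add_cancel]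

open scoped ComplexOrder in
-- Full row rank of `[A B]` makes its conjugate transpose injective.
lemma eq_zero_of_conjTranspose_mulVec (hr : (fromCols A B).rank = Fintype.card ι) {c : ι → ℂ}
    (h1 : (-Bᴴ).mulVec c = 0) (h2 : Aᴴ.mulVec c = 0) : c = 0 := by
  have hli : LinearIndependent ℂ ((fromCols A B)ᴴ).col := by
    rw [linearIndependent_iff_card_eq_finrank_span, Set.finrank,
      ← rank_eq_finrank_span_cols, rank_conjTranspose, hr]
  refine mulVec_injective_iff.2 hli ?_
  rw [mulVec_zero, conjTranspose_fromCols_eq_fromRows_conjTranspose, fromRows_mulVec, h2]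
  rw [neg_mulVec, neg_eq_zero] at h1
  rw [h1]
  ext (i | i) <;> rfl

/-- The range of `[-B*; A*]` lies in the kernel of `[A B]` by the commutation relation. Both have
dimension `n`, the first by injectivity and the second as `2n - n`, so they coincide. -/
lemma exists_eq_conjTranspose_mulVec (hr : (fromCols A B).rank = Fintype.card ι)
    (hAB : A * Bᴴ = B * Aᴴ) {p q : ι → ℂ} (h : A.mulVec p + B.mulVec q = 0) :
    ∃ c, p = (-Bᴴ).mulVec c ∧ q = Aᴴ.mulVec c := by
  set f := (fromCols A B).mulVecLin
  set g := (fromRows (-Bᴴ) Aᴴ).mulVecLin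
  have hg : Function.Injective g := by
    rw [← LinearMap.ker_eq_bot, LinearMap.ker_eq_bot']
    intro c hc
    have h' : Sum.elim ((-Bᴴ).mulVec c) (Aᴴ.mulVec c) = 0 := by rw [← fromRows_mulVec]; exact hc
    exact eq_zero_of_conjTranspose_mulVec hr
      (funext fun i => congrFun h' (Sum.inl i)) (funext fun i => congrFun h' (Sum.inr i))
  have hle : LinearMap.range g ≤ LinearMap.ker f := by
    rintro _ ⟨c, rfl⟩
    change (fromCols A B).mulVec ((fromRows (-Bᴴ) Aᴴ).mulVec c) = 0
    rw [fromRows_mulVec, fromCols_mulVec_sumElim, mulVec_neg_conjTranspose_add hAB]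
  have hfin : Module.finrank ℂ (LinearMap.range g) = Module.finrank ℂ (LinearMap.ker f) := by
    have h1 := LinearMap.finrank_range_of_inj hg
    have h2 := LinearMap.finrank_range_add_finrank_ker f
    have h3 : Module.finrank ℂ (LinearMap.range f) = Fintype.card ι := hr
    simp only [Module.finrank_fintype_fun_eq_card, Fintype.card_sum] at h1 h2
    omega
  have hmem : Sum.elim p q ∈ LinearMap.ker f := by
    change (fromCols A B).mulVec (Sum.elim p q) = 0
    rw [fromCols_mulVec_sumElim, h]
  rw [← Submodule.eq_of_le_of_finrank_eq hle hfin] at hmem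
  obtain ⟨c, hc⟩ := hmem
  have h' : Sum.elim ((-Bᴴ).mulVec c) (Aᴴ.mulVec c) = Sum.elim p q := by
    rw [← fromRows_mulVec]; exact hc
  exact ⟨c, funext fun i => (congrFun h' (Sum.inl i)).symm,
    funext fun i => (congrFun h' (Sum.inr i)).symm⟩

variable [DecidableEq ι]

/-- On boundary data `p = -B* c`, `q = A* c` the form `p* q` equals `-c* (B A*) c`. As `B A* = A
B*`, it depends only on `B* c`, hence is a quadratic form in the values `p` alone. -/
lemma exists_norm_star_dotProduct_le (hAB : A * Bᴴ = B * Aᴴ) :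
    ∃ C : ℝ, 0 ≤ C ∧ ∀ c : ι → ℂ, ‖star ((-Bᴴ).mulVec c) ⬝ᵥ Aᴴ.mulVec c‖ ≤
      C * ∑ i, ‖(-Bᴴ).mulVec c i‖ ^ 2 := by
  -- `G` is a generalized inverse of `B*`: a right inverse of the map onto its range, extended
  -- linearly to the whole space.
  obtain ⟨G, hG⟩ : ∃ G : Matrix ι ι ℂ, Bᴴ * G * Bᴴ = Bᴴ := by
    obtain ⟨s, hs⟩ := (Bᴴ.mulVecLin.rangeRestrict).exists_rightInverse_of_surjective
      (LinearMap.range_rangeRestrict _)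
    obtain ⟨t, ht⟩ := s.exists_extend
    refine ⟨LinearMap.toMatrix' t, ?_⟩
    refine ext_iff_mulVec.2 fun c => ?_
    rw [← mulVec_mulVec, ← mulVec_mulVec, LinearMap.toMatrix'_mulVec]
    have h1 : t (Bᴴ.mulVec c) = s (Bᴴ.mulVecLin.rangeRestrict c) :=
      congrArg (fun f => f (Bᴴ.mulVecLin.rangeRestrict c)) ht
    have h2 := congrArg (fun f => (f (Bᴴ.mulVecLin.rangeRestrict c) : ι → ℂ)) hs
    rw [h1]
    exact h2
  set S : Matrix ι ι ℂ := Aᴴ * G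
  have key : ∀ c : ι → ℂ, star ((-Bᴴ).mulVec c) ⬝ᵥ Aᴴ.mulVec c =
      -(star ((-Bᴴ).mulVec c) ⬝ᵥ S.mulVec ((-Bᴴ).mulVec c)) := by
    intro c
    have e : ∀ y : ι → ℂ, star ((-Bᴴ).mulVec c) ⬝ᵥ y = -(star c ⬝ᵥ B.mulVec y) := by
      intro y
      rw [star_mulVec, conjTranspose_neg, conjTranspose_conjTranspose, vecMul_neg, neg_dotProduct,
        dotProduct_mulVec]
    have hm : B * S * Bᴴ = B * Aᴴ := by
      rw [← mul_assoc, ← hAB, mul_assoc A, mul_assoc A, hG]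
    rw [e, e, mulVec_mulVec, mulVec_mulVec, mulVec_mulVec, mul_neg, hm, neg_mulVec,
      dotProduct_neg, neg_neg]
  refine ⟨∑ i, ∑ k, ‖S i k‖, by positivity, fun c => ?_⟩
  set y := (-Bᴴ).mulVec c
  rw [key, norm_neg, Finset.sum_mul]
  refine (norm_sum_le _ _).trans (Finset.sum_le_sum fun i _ => ?_)
  rw [Pi.star_apply, norm_mul, norm_star, Finset.sum_mul, mulVec, dotProduct]
  refine (mul_le_mul_of_nonneg_left (norm_sum_le _ _) (norm_nonneg _)).trans ?_
  rw [Finset.mul_sum]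
  refine Finset.sum_le_sum fun k _ => ?_
  have h1 : ∀ i, ‖y i‖ ^ 2 ≤ ∑ l, ‖y l‖ ^ 2 := fun i =>
    Finset.single_le_sum (f := fun l => ‖y l‖ ^ 2) (fun l _ => by positivity) (Finset.mem_univ i)
  rw [norm_mul]
  have h2 : ‖y i‖ * ‖y k‖ ≤ ∑ l, ‖y l‖ ^ 2 := by
    nlinarith [h1 i, h1 k, sq_nonneg (‖y i‖ - ‖y k‖)]
  calc ‖y i‖ * (‖S i k‖ * ‖y k‖) = ‖S i k‖ * (‖y i‖ * ‖y k‖) := by ring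
    _ ≤ _ := mul_le_mul_of_nonneg_left h2 (norm_nonneg _)

/-- A `2 × 2` block matrix of diagonal matrices. -/
lemma det_fromBlocks_diagonal (p q r s : ι → ℂ) :
    (fromBlocks (diagonal p) (diagonal q) (diagonal r) (diagonal s)).det =
      ∏ i, (p i * s i - q i * r i) := by
  let e : Fin 2 × ι ≃ ι ⊕ ι := (finTwoEquiv.prodCongr (Equiv.refl ι)).trans (Equiv.boolProdEquivSum ι)
  have h : (fromBlocks (diagonal p) (diagonal q) (diagonal r) (diagonal s)).submatrix e e =
      blockDiagonal fun i => !![p i, q i; r i, s i] := by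
    ext ⟨i, k⟩ ⟨i', k'⟩
    fin_cases i <;> fin_cases i' <;>
      simp [e, blockDiagonal_apply, Matrix.diagonal_apply, Equiv.boolProdEquivSum, finTwoEquiv]
  rw [← det_submatrix_equiv_self e, h, det_blockDiagonal]
  simp [det_fin_two]

end Matrices

end

noncomputable section

/-! ### Boundary value problems and the Evans function -/

lemma IsIVPSolution.sum {κ : Type*} [Fintype κ] {a b x₀ : ℝ} {V : ℝ → ℂ} {z : ℂ} {p q : κ → ℂ}
    {w : κ → (ℝ → ℂ) × (ℝ → ℂ)} (h : ∀ i, IsIVPSolution V z a b x₀ (p i) (q i) (w i)) (c : κ → ℂ) :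
    IsIVPSolution V z a b x₀ (∑ i, p i * c i) (∑ i, q i * c i) (∑ i, c i • w i) := by
  refine ⟨?_, ?_, ?_⟩
  · rw [Prod.fst_sum, Prod.snd_sum]
    exact IsEdgeSolution.sum _ fun i _ => (h i).1.smul (c i)
  · simp [Prod.fst_sum, (h _).2.1, mul_comm]
  · simp [Prod.snd_sum, (h _).2.2, mul_comm]

variable {ι : Type}

/-- All edges are non-degenerate and all potentials are integrable. -/
structure StarGraph.IsRegular (G : StarGraph ι) : Prop where
  lt : ∀ i, G.inner i < G.outer i
  integrableOn : ∀ i, IntegrableOn (G.potential i) (Ioo (G.inner i) (G.outer i))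

lemma StarGraph.IsRegular.left_mem {G : StarGraph ι} (hG : G.IsRegular) (i : ι) :
    G.inner i ∈ Icc (G.inner i) (G.outer i) := left_mem_Icc.2 (hG.lt i).le

lemma StarGraph.IsRegular.right_mem {G : StarGraph ι} (hG : G.IsRegular) (i : ι) :
    G.outer i ∈ Icc (G.inner i) (G.outer i) := right_mem_Icc.2 (hG.lt i).le

/-- The solution with data `e` at the central vertex. -/
def initialSolution (G : StarGraph ι) (z : ℂ) (e : ι ⊕ ι → ℂ) (k : ι) : (ℝ → ℂ) × (ℝ → ℂ) :=
  e (Sum.inl k) • ivpSolution (G.potential k) z (G.inner k) (G.outer k) (G.inner k) 1 0 +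
    e (Sum.inr k) • ivpSolution (G.potential k) z (G.inner k) (G.outer k) (G.inner k) 0 1

lemma isIVPSolution_initialSolution {G : StarGraph ι} (hG : G.IsRegular) (z : ℂ) (e : ι ⊕ ι → ℂ)
    (k : ι) : IsIVPSolution (G.potential k) z (G.inner k) (G.outer k) (G.inner k) (e (Sum.inl k))
      (e (Sum.inr k)) (initialSolution G z e k) := by
  obtain ⟨h, h1, h2⟩ := isIVPSolution_left (hG.lt k) (hG.integrableOn k) z 1 0
  obtain ⟨l, l1, l2⟩ := isIVPSolution_left (hG.lt k) (hG.integrableOn k) z 0 1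
  refine ⟨(h.smul _).add (l.smul _), ?_, ?_⟩
  · simp [initialSolution, h1, l1]
  · simp [initialSolution, h2, l2]

variable [Fintype ι] {G : StarGraph ι} {Γ : BoundaryConditions ι} {z : ℂ}

lemma isIVPSolution_sum_solY (hG : G.IsRegular) (Γ : BoundaryConditions ι) (z : ℂ) (c : ι → ℂ)
    (k : ι) :
    IsIVPSolution (G.potential k) z (G.inner k) (G.outer k) (G.inner k)
      ((-Γ.α₂.conjTranspose).mulVec c k) (Γ.α₁.conjTranspose.mulVec c k)
      (∑ i, c i • solY G Γ z k i) :=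
  IsIVPSolution.sum (fun i => isIVPSolution_ivpSolution (hG.lt k) (hG.integrableOn k) z
    ((-Γ.α₂.conjTranspose) k i) (Γ.α₁.conjTranspose k i) (hG.left_mem k)) c

lemma isIVPSolution_sum_solZ (hG : G.IsRegular) (Γ : BoundaryConditions ι) (z : ℂ) (c : ι → ℂ)
    (k : ι) :
    IsIVPSolution (G.potential k) z (G.inner k) (G.outer k) (G.outer k)
      ((-Γ.β₂.conjTranspose).mulVec c k) (Γ.β₁.conjTranspose.mulVec c k)
      (∑ i, c i • solZ G Γ z k i) :=
  IsIVPSolution.sum (fun i => isIVPSolution_ivpSolution (hG.lt k) (hG.integrableOn k) z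
    ((-Γ.β₂.conjTranspose) k i) (Γ.β₁.conjTranspose k i) (hG.right_mem k)) c

lemma fundamentalMatrix_mulVec (x : ι → ℝ) (c d : ι → ℂ) :
    (fundamentalMatrix G Γ x z).mulVec (Sum.elim c d) =
      Sum.elim
        (fun k => (∑ i, c i • solY G Γ z k i).1 (x k) + (∑ i, d i • solZ G Γ z k i).1 (x k))
        (fun k => (∑ i, c i • solY G Γ z k i).2 (x k) + (∑ i, d i • solZ G Γ z k i).2 (x k)) := by
  rw [fundamentalMatrix, Matrix.fromBlocks_mulVec]
  ext (k | k) <;>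
    simp [Matrix.mulVec, dotProduct, Prod.fst_sum, Prod.snd_sum, mul_comm]

variable [DecidableEq ι]

/-- The Evans function does not depend on the points at which it is computed. -/
lemma evans_eq_inner (hG : G.IsRegular) (Γ : BoundaryConditions ι) {x : ι → ℝ} (hx : IsPoint G x)
    (z : ℂ) : evans G Γ x z = evans G Γ G.inner z := by
  let θ : ι → (ℝ → ℂ) × (ℝ → ℂ) := fun k =>
    ivpSolution (G.potential k) z (G.inner k) (G.outer k) (G.inner k) 1 0
  let φ : ι → (ℝ → ℂ) × (ℝ → ℂ) := fun k =>
    ivpSolution (G.potential k) z (G.inner k) (G.outer k) (G.inner k) 0 1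
  have hfact : fundamentalMatrix G Γ x z =
      Matrix.fromBlocks (Matrix.diagonal fun k => (θ k).1 (x k))
        (Matrix.diagonal fun k => (φ k).1 (x k)) (Matrix.diagonal fun k => (θ k).2 (x k))
        (Matrix.diagonal fun k => (φ k).2 (x k)) * fundamentalMatrix G Γ G.inner z := by
    have hY := fun k i => (isIVPSolution_ivpSolution (hG.lt k) (hG.integrableOn k) z
      ((-Γ.α₂.conjTranspose) k i) (Γ.α₁.conjTranspose k i) (hG.left_mem k)).1.eq_combination
        (hG.lt k) (hG.integrableOn k) (hx k)
    have hZ := fun k i => (isIVPSolution_ivpSolution (hG.lt k) (hG.integrableOn k) z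
      ((-Γ.β₂.conjTranspose) k i) (Γ.β₁.conjTranspose k i) (hG.right_mem k)).1.eq_combination
        (hG.lt k) (hG.integrableOn k) (hx k)
    rw [fundamentalMatrix, fundamentalMatrix, Matrix.fromBlocks_multiply]
    congr 1 <;> ext k i <;>
      simp only [Matrix.of_apply, Matrix.add_apply, Matrix.diagonal_mul]
    · exact (hY k i).1
    · exact (hZ k i).1
    · exact (hY k i).2
    · exact (hZ k i).2
  rw [evans, hfact, Matrix.det_mul, det_fromBlocks_diagonal, Finset.prod_eq_one, one_mul, evans]
  exact fun k _ => ivpSolution_wronskian (hG.lt k) (hG.integrableOn k) z (hx k)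

lemma differentiable_evans (hG : G.IsRegular) (Γ : BoundaryConditions ι) {x : ι → ℝ}
    (hx : IsPoint G x) : Differentiable ℂ (evans G Γ x) := by
  have h : ∀ i j, Differentiable ℂ fun z => fundamentalMatrix G Γ x z i j := by
    have hY := fun k i => differentiable_ivpSolution (hG.lt k) (hG.integrableOn k)
      ((-Γ.α₂.conjTranspose) k i) (Γ.α₁.conjTranspose k i) (hG.left_mem k) (hx k)
    have hZ := fun k i => differentiable_ivpSolution (hG.lt k) (hG.integrableOn k)
      ((-Γ.β₂.conjTranspose) k i) (Γ.β₁.conjTranspose k i) (hG.right_mem k) (hx k)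
    rintro (k | k) (i | i)
    · exact (hY k i).1
    · exact (hZ k i).1
    · exact (hY k i).2
    · exact (hZ k i).2
  have he : evans G Γ x = fun z => ∑ σ : Equiv.Perm (ι ⊕ ι), (Equiv.Perm.sign σ : ℤ) •
      ∏ i, fundamentalMatrix G Γ x z (σ i) i := by
    ext1 z
    exact Matrix.det_apply _
  rw [he]
  refine Differentiable.fun_sum fun σ _ => Differentiable.const_smul ?_ _
  exact Differentiable.fun_finsetProd fun i _ => h _ _

lemma IsBVPSolution.sub {f g : ι ⊕ ι → ℂ} {u u' v v' : ι → ℝ → ℂ} (h : IsBVPSolution G Γ z f u u')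
    (k : IsBVPSolution G Γ z g v v') : IsBVPSolution G Γ z (f - g) (u - v) (u' - v') := by
  refine ⟨fun i => (h.1 i).sub (k.1 i), ?_⟩
  have h1 := trace_add G Γ u u' ((-1 : ℂ) • v) ((-1 : ℂ) • v')
  rw [trace_smul, h.2, k.2, neg_one_smul, neg_one_smul, neg_one_smul] at h1
  simpa [sub_eq_add_neg] using h1

lemma trace_inl_eq_zero_iff (hΓ : Γ.IsSelfAdjoint) {u u' : ι → ℝ → ℂ} :
    Γ.β₁.mulVec (fun i => u i (G.outer i)) + Γ.β₂.mulVec (fun i => u' i (G.outer i)) = 0 ↔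
    ∃ d, (∀ i, u i (G.outer i) = (-Γ.β₂.conjTranspose).mulVec d i) ∧
      ∀ i, u' i (G.outer i) = Γ.β₁.conjTranspose.mulVec d i := by
  constructor
  · intro h
    obtain ⟨d, h1, h2⟩ := exists_eq_conjTranspose_mulVec hΓ.rank_β hΓ.comm_β h
    exact ⟨d, fun i => congrFun h1 i, fun i => congrFun h2 i⟩
  · rintro ⟨d, h1, h2⟩
    rw [funext h1, funext h2]
    exact mulVec_neg_conjTranspose_add hΓ.comm_β d

lemma trace_inr_eq_zero_iff (hΓ : Γ.IsSelfAdjoint) {u u' : ι → ℝ → ℂ} :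
    Γ.α₁.mulVec (fun i => u i (G.inner i)) + Γ.α₂.mulVec (fun i => u' i (G.inner i)) = 0 ↔
    ∃ c, (∀ i, u i (G.inner i) = (-Γ.α₂.conjTranspose).mulVec c i) ∧
      ∀ i, u' i (G.inner i) = Γ.α₁.conjTranspose.mulVec c i := by
  constructor
  · intro h
    obtain ⟨d, h1, h2⟩ := exists_eq_conjTranspose_mulVec hΓ.rank_α hΓ.comm_α h
    exact ⟨d, fun i => congrFun h1 i, fun i => congrFun h2 i⟩
  · rintro ⟨d, h1, h2⟩
    rw [funext h1, funext h2]
    exact mulVec_neg_conjTranspose_add hΓ.comm_α d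

/-- A function satisfies the homogeneous boundary conditions if and only if its data at the
vertices are those of linear combinations of the columns of `Y` and of `Z`. -/
lemma trace_eq_zero_iff (hΓ : Γ.IsSelfAdjoint) {u u' : ι → ℝ → ℂ} :
    trace G Γ u u' = 0 ↔
      (∃ d, (∀ i, u i (G.outer i) = (-Γ.β₂.conjTranspose).mulVec d i) ∧
        ∀ i, u' i (G.outer i) = Γ.β₁.conjTranspose.mulVec d i) ∧
      ∃ c, (∀ i, u i (G.inner i) = (-Γ.α₂.conjTranspose).mulVec c i) ∧
        ∀ i, u' i (G.inner i) = Γ.α₁.conjTranspose.mulVec c i := by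
  rw [← trace_inl_eq_zero_iff hΓ, ← trace_inr_eq_zero_iff hΓ]
  constructor
  · intro h
    exact ⟨funext fun i => congrFun h (Sum.inl i), funext fun i => congrFun h (Sum.inr i)⟩
  · rintro ⟨h1, h2⟩
    rw [trace, h1, h2]
    ext (i | i) <;> rfl

/-- The solution is a combination `Y c` from the central vertex and `Z d` from the outer ones.
Equating the two puts `(c, -d)` in the kernel of the fundamental matrix. -/
lemma IsBVPSolution.eq_zero (hG : G.IsRegular) (hΓ : Γ.IsSelfAdjoint)
    (hE : evans G Γ G.inner z ≠ 0) {u u' : ι → ℝ → ℂ} (h : IsBVPSolution G Γ z 0 u u') (i : ι) :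
    ∀ x ∈ Icc (G.inner i) (G.outer i), u i x = 0 ∧ u' i x = 0 := by
  obtain ⟨⟨d, d1, d2⟩, c, c1, c2⟩ := (trace_eq_zero_iff hΓ).1 h.2
  have hY := fun k => isIVPSolution_sum_solY hG Γ z c k
  have hZ := fun k => isIVPSolution_sum_solZ hG Γ z (-d) k
  have hZ' := fun k => (h.1 k).eq_of_point (hG.lt k) (hG.integrableOn k) ((hZ k).1.smul (-1))
    (hG.right_mem k) (by rw [d1, Pi.smul_apply, (hZ k).2.1, Matrix.mulVec_neg]; simp)
    (by rw [d2, Pi.smul_apply, (hZ k).2.2, Matrix.mulVec_neg]; simp) _ (hG.left_mem k)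
  have hker : (fundamentalMatrix G Γ G.inner z).mulVec (Sum.elim c (-d)) = 0 := by
    rw [fundamentalMatrix_mulVec]
    ext (k | k)
    · have := (hZ' k).1
      simp only [Sum.elim_inl, (hY k).2.1, Pi.zero_apply, ← c1, this]
      simp
    · have := (hZ' k).2
      simp only [Sum.elim_inr, (hY k).2.2, Pi.zero_apply, ← c2, this]
      simp
  have h0 := Matrix.eq_zero_of_mulVec_eq_zero hE hker
  have hc : c = 0 := funext fun k => congrFun h0 (Sum.inl k)
  exact (h.1 i).eq_zero_of_point (hG.lt i) (hG.integrableOn i) (hG.left_mem i) (by simp [c1, hc])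
    (by simp [c2, hc])

/-- For a kernel vector `(c, d)` the functions `Y c` and `-Z d` have the same Cauchy data, hence
coincide, and satisfy the conditions at both ends. The rank conditions prevent a nonzero kernel
vector from giving the zero function. -/
lemma exists_isBVPSolution_zero_of_evans_eq_zero (hG : G.IsRegular) (hΓ : Γ.IsSelfAdjoint)
    (hE : evans G Γ G.inner z = 0) :
    ∃ u u', IsBVPSolution G Γ z 0 u u' ∧
      ¬ ∀ i, ∀ x ∈ Icc (G.inner i) (G.outer i), u i x = 0 ∧ u' i x = 0 := by
  obtain ⟨v, hv, hker⟩ := Matrix.exists_mulVec_eq_zero_iff.2 hE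
  obtain ⟨c, d, rfl⟩ : ∃ c d, v = Sum.elim c d :=
    ⟨fun i => v (Sum.inl i), fun i => v (Sum.inr i), by ext (i | i) <;> rfl⟩
  rw [fundamentalMatrix_mulVec] at hker
  have hY := fun k => isIVPSolution_sum_solY hG Γ z c k
  have hZ := fun k => isIVPSolution_sum_solZ hG Γ z d k
  have hYZ := fun k => (hY k).1.eq_of_point (hG.lt k) (hG.integrableOn k) ((hZ k).1.smul (-1))
    (hG.left_mem k) (by simpa [eq_neg_iff_add_eq_zero] using congrFun hker (Sum.inl k))
    (by simpa [eq_neg_iff_add_eq_zero] using congrFun hker (Sum.inr k)) _ (hG.right_mem k)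
  have hd1 : ∀ k, (∑ i, c i • solY G Γ z k i).1 (G.outer k) =
      (-Γ.β₂.conjTranspose).mulVec (-d) k := fun k => by
    rw [(hYZ k).1, Matrix.mulVec_neg, Pi.neg_apply, ← (hZ k).2.1]
    simp
  have hd2 : ∀ k, (∑ i, c i • solY G Γ z k i).2 (G.outer k) =
      Γ.β₁.conjTranspose.mulVec (-d) k := fun k => by
    rw [(hYZ k).2, Matrix.mulVec_neg, Pi.neg_apply, ← (hZ k).2.2]
    simp
  refine ⟨fun k => (∑ i, c i • solY G Γ z k i).1, fun k => (∑ i, c i • solY G Γ z k i).2,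
    ⟨fun k => (hY k).1, (trace_eq_zero_iff hΓ).2 ⟨⟨-d, hd1, hd2⟩, c, fun k => (hY k).2.1,
      fun k => (hY k).2.2⟩⟩, fun h => hv ?_⟩
  have hc : c = 0 := eq_zero_of_conjTranspose_mulVec hΓ.rank_α
    (funext fun k => by rw [← (hY k).2.1]; exact (h k _ (hG.left_mem k)).1)
    (funext fun k => by rw [← (hY k).2.2]; exact (h k _ (hG.left_mem k)).2)
  have hd : -d = 0 := eq_zero_of_conjTranspose_mulVec hΓ.rank_β
    (funext fun k => by rw [← hd1]; exact (h k _ (hG.right_mem k)).1)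
    (funext fun k => by rw [← hd2]; exact (h k _ (hG.right_mem k)).2)
  rw [neg_eq_zero] at hd
  rw [hc, hd]
  ext (i | i) <;> rfl

/-- The trace of a solution as a function of its data at the central vertex. -/
def traceMap (G : StarGraph ι) (Γ : BoundaryConditions ι) (z : ℂ) :
    (ι ⊕ ι → ℂ) →ₗ[ℂ] (ι ⊕ ι → ℂ) where
  toFun e := trace G Γ (fun k => (initialSolution G z e k).1) fun k => (initialSolution G z e k).2
  map_add' e e' := by
    rw [← trace_add]
    congr 1 <;> ext k x <;> simp [initialSolution] <;> ring
  map_smul' c e := by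
    rw [RingHom.id_apply, ← trace_smul]
    congr 1 <;> ext k x <;> simp [initialSolution] <;> ring

lemma isBVPSolution_initialSolution (hG : G.IsRegular) (Γ : BoundaryConditions ι) (z : ℂ)
    (e : ι ⊕ ι → ℂ) : IsBVPSolution G Γ z (traceMap G Γ z e)
      (fun k => (initialSolution G z e k).1) fun k => (initialSolution G z e k).2 :=
  ⟨fun k => (isIVPSolution_initialSolution hG z e k).1, rfl⟩

lemma traceMap_injective (hG : G.IsRegular) (hΓ : Γ.IsSelfAdjoint)
    (hE : evans G Γ G.inner z ≠ 0) : Function.Injective (traceMap G Γ z) := by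
  rw [← LinearMap.ker_eq_bot, LinearMap.ker_eq_bot']
  intro e he
  have h := isBVPSolution_initialSolution hG Γ z e
  rw [he] at h
  ext (k | k)
  · rw [← (isIVPSolution_initialSolution hG z e k).2.1]
    exact (h.eq_zero hG hΓ hE k _ (hG.left_mem k)).1
  · rw [← (isIVPSolution_initialSolution hG z e k).2.2]
    exact (h.eq_zero hG hΓ hE k _ (hG.left_mem k)).2

/-- The trace map is an injective endomorphism of a finite-dimensional space, so uniqueness for zero
trace gives existence for every trace. -/
lemma hasUniqueBVPSolution (hG : G.IsRegular) (hΓ : Γ.IsSelfAdjoint)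
    (hE : evans G Γ G.inner z ≠ 0) (f : ι ⊕ ι → ℂ) : HasUniqueBVPSolution G Γ z f := by
  constructor
  · obtain ⟨e, rfl⟩ := LinearMap.injective_iff_surjective.1 (traceMap_injective hG hΓ hE) f
    exact ⟨_, _, isBVPSolution_initialSolution hG Γ z e⟩
  · intro u u' v v' h k i x hx
    have hs := h.sub k
    rw [sub_self] at hs
    have := (hs.eq_zero hG hΓ hE i x hx).1
    simpa [sub_eq_zero] using this

end

noncomputable section

/-! ### The Evans function does not vanish identically -/

section Edge

variable {a b : ℝ} {u u' u'' : ℝ → ℂ} {V : ℝ → ℂ} {z : ℂ}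

lemma IsW21.deriv_eq_zero (hab : a < b) (h : IsW21 a b u u' u'') (h0 : ∀ x ∈ Icc a b, u x = 0) :
    ∀ x ∈ Icc a b, u' x = 0 := fun x hx =>
  (uniqueDiffOn_Icc hab x hx).eq_deriv _ (h.hasDeriv x hx)
    ((hasDerivWithinAt_const x _ (0 : ℂ)).congr h0 (h0 x hx))

lemma IsW21.intervalIntegrable_norm_sq (hab : a ≤ b) (h : IsW21 a b u u' u'') :
    IntervalIntegrable (fun t => ‖u t‖ ^ 2) volume a b ∧
      IntervalIntegrable (fun t => ‖u' t‖ ^ 2) volume a b := by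
  constructor
  · refine ContinuousOn.intervalIntegrable ?_
    rw [uIcc_of_le hab]
    exact h.continuousOn.norm.pow 2
  · refine ContinuousOn.intervalIntegrable ?_
    rw [uIcc_of_le hab]
    exact h.continuousOn_deriv.norm.pow 2

/-- A Sobolev inequality. -/
lemma IsW21.norm_sq_le (hab : a < b) (h : IsW21 a b u u' u'') {ε : ℝ} (hε : 0 < ε) {x : ℝ}
    (hx : x ∈ Icc a b) :
    ‖u x‖ ^ 2 ≤ ε * (∫ t in a..b, ‖u' t‖ ^ 2) + (1 / ε + 1 / (b - a)) * ∫ t in a..b, ‖u t‖ ^ 2 := by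
  obtain ⟨i0, i1⟩ := h.intervalIntegrable_norm_sq hab.le
  set A := ∫ t in a..b, ‖u' t‖ ^ 2
  set B := ∫ t in a..b, ‖u t‖ ^ 2
  set g : ℝ → ℝ := fun t => ε * ‖u' t‖ ^ 2 + 1 / ε * ‖u t‖ ^ 2 with hg
  have gi : IntervalIntegrable g volume a b := (i1.const_mul ε).add (i0.const_mul (1 / ε))
  have hgI : ∫ t in a..b, g t = ε * A + 1 / ε * B := by
    rw [intervalIntegral.integral_add (i1.const_mul ε) (i0.const_mul (1 / ε)),
      intervalIntegral.integral_const_mul, intervalIntegral.integral_const_mul]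
  have hle : ∀ y w, y ∈ Icc a b → w ∈ Icc a b → y ≤ w →
      |‖u w‖ ^ 2 - ‖u y‖ ^ 2| ≤ ε * A + 1 / ε * B := by
    intro y w hy hw hyw
    have hsub : Icc y w ⊆ Icc a b := Icc_subset_Icc hy.1 hw.2
    have c1 : ContinuousOn (fun t => 2 * inner ℝ (u t) (u' t)) (Icc y w) :=
      continuousOn_const.mul (ContinuousOn.inner (𝕜 := ℝ) (h.continuousOn.mono hsub)
        (h.continuousOn_deriv.mono hsub))
    have c2 : ContinuousOn g (Icc y w) :=
      (continuousOn_const.mul ((h.continuousOn_deriv.mono hsub).norm.pow 2)).add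
        (continuousOn_const.mul ((h.continuousOn.mono hsub).norm.pow 2))
    have e := intervalIntegral.integral_eq_sub_of_hasDerivAt_of_le (f := fun t => ‖u t‖ ^ 2)
      (f' := fun t => 2 * inner ℝ (u t) (u' t)) hyw ((h.continuousOn.mono hsub).norm.pow 2)
      (fun t ht => ((h.hasDeriv t (hsub (Ioo_subset_Icc_self ht))).hasDerivAt
        (Icc_mem_nhds (hy.1.trans_lt ht.1) (ht.2.trans_le hw.2))).norm_sq)
      (by rw [← uIcc_of_le hyw] at c1; exact c1.intervalIntegrable)
    rw [← e, ← hgI, ← Real.norm_eq_abs]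
    refine (intervalIntegral.norm_integral_le_integral_norm hyw).trans ?_
    refine (intervalIntegral.integral_mono_on hyw
      (by rw [← uIcc_of_le hyw] at c1; exact c1.norm.intervalIntegrable)
      (by rw [← uIcc_of_le hyw] at c2; exact c2.intervalIntegrable) fun t _ => ?_).trans
      (intervalIntegral.integral_mono_interval hy.1 hyw hw.2
        (Eventually.of_forall fun t => by simp only [hg, Pi.zero_apply]; positivity) gi)
    rw [norm_mul, Real.norm_two]
    refine (mul_le_mul_of_nonneg_left (norm_inner_le_norm (𝕜 := ℝ) _ _) zero_le_two).trans ?_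
    -- Completing the square: `2 ‖u‖ ‖u'‖ ≤ ε ‖u'‖² + ‖u‖² / ε`.
    have hs : 0 ≤ (ε * ‖u' t‖ - ‖u t‖) ^ 2 / ε := by positivity
    have he : (ε * ‖u' t‖ - ‖u t‖) ^ 2 / ε = g t - 2 * (‖u t‖ * ‖u' t‖) := by
      simp only [hg]; field_simp; ring
    linarith
  have hle' : ∀ y ∈ Icc a b, ‖u x‖ ^ 2 ≤ ‖u y‖ ^ 2 + (ε * A + 1 / ε * B) := by
    intro y hy
    rcases le_total y x with hyx | hxy
    · linarith [le_abs_self (‖u x‖ ^ 2 - ‖u y‖ ^ 2), hle y x hy hx hyx]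
    · linarith [neg_abs_le (‖u y‖ ^ 2 - ‖u x‖ ^ 2), hle x y hx hy hxy]
  -- Averaging over `y` replaces `‖u y‖²` by its mean, the source of the term `1 / (b - a)`.
  have hI := intervalIntegral.integral_mono_on hab.le (_root_.intervalIntegrable_const)
    (i0.add _root_.intervalIntegrable_const) hle'
  rw [intervalIntegral.integral_add i0 _root_.intervalIntegrable_const,
    intervalIntegral.integral_const, intervalIntegral.integral_const, smul_eq_mul, smul_eq_mul] at hI
  have hl : 0 < b - a := sub_pos.2 hab
  have : (b - a) * ‖u x‖ ^ 2 ≤ (b - a) * (ε * A + (1 / ε + 1 / (b - a)) * B) := by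
    refine hI.trans (le_of_eq ?_)
    change B + _ = _
    field_simp
    ring
  exact le_of_mul_le_mul_left this hl

/-- The energy identity, as an inequality. -/
lemma IsEdgeSolution.energy_le (hab : a ≤ b) (hV : IntegrableOn V (Ioo a b)) {r : ℝ}
    (h : IsEdgeSolution V (-(r : ℂ)) a b u u') {S : ℝ} (hS : ∀ x ∈ Icc a b, ‖u x‖ ^ 2 ≤ S) :
    (∫ t in a..b, ‖u' t‖ ^ 2) + r * (∫ t in a..b, ‖u t‖ ^ 2) ≤
      (∫ t in a..b, ‖V t‖) * S + (star (u b) * u' b - star (u a) * u' a).re := by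
  have hb := right_mem_Icc.2 hab
  have hVi : IntervalIntegrable V volume a b := intervalIntegrable_of_mem hV hb
  obtain ⟨i0, i1⟩ := h.intervalIntegrable_norm_sq hab
  have cu' : ContinuousOn u' (uIcc a b) := by rw [uIcc_of_le hab]; exact h.continuousOn_deriv
  have cu : ContinuousOn u (uIcc a b) := by rw [uIcc_of_le hab]; exact h.continuousOn
  obtain ⟨hi, he⟩ := IntervalIntegrable.integral_primitive_mul (f := fun x => star (u x))
    (f' := fun x => star (u' x)) (g := u') (g' := fun x => (V x - -(r : ℂ)) * u x) hab
    cu'.star.intervalIntegrable (h.intervalIntegrable hb)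
    (fun x hx => by
      rw [h.eq_add_integral_deriv hx, star_add, intervalIntegral.integral_of_le hx.1,
        intervalIntegral.integral_of_le hx.1]
      congr 1
      exact integral_conj.symm) h.integral_eq
  -- Real part of the integral of `(ū u')' = |u'|² + (V + r) |u|²`; only `Re V` survives, so complex
  -- potentials are allowed.
  have hre : ∫ t in a..b, (‖u' t‖ ^ 2 + (V t).re * ‖u t‖ ^ 2 + r * ‖u t‖ ^ 2) =
      (star (u b) * u' b - star (u a) * u' a).re := by
    rw [← he, ← RCLike.re_eq_complex_re, ← intervalIntegral.intervalIntegral_re hi]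
    refine intervalIntegral.integral_congr fun t _ => ?_
    simp only [RCLike.re_eq_complex_re, ← Complex.normSq_eq_norm_sq, Complex.normSq_apply,
      Complex.add_re, Complex.mul_re, Complex.star_def, Complex.conj_re, Complex.conj_im,
      Complex.sub_re, Complex.neg_re, Complex.ofReal_re, Complex.mul_im, Complex.sub_im,
      Complex.neg_im, Complex.ofReal_im]
    ring
  have iV : IntervalIntegrable (fun t => (V t).re * ‖u t‖ ^ 2) volume a b :=
    IntervalIntegrable.mul_continuousOn (f := fun t => (V t).re)
      ⟨hVi.1.re, hVi.2.re⟩ (cu.norm.pow 2)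
  rw [intervalIntegral.integral_add (i1.add iV) (i0.const_mul r),
    intervalIntegral.integral_add i1 iV, intervalIntegral.integral_const_mul] at hre
  have hVle : -(∫ t in a..b, (V t).re * ‖u t‖ ^ 2) ≤ (∫ t in a..b, ‖V t‖) * S := by
    rw [← intervalIntegral.integral_neg, ← intervalIntegral.integral_mul_const]
    refine intervalIntegral.integral_mono_on hab iV.neg (hVi.norm.mul_const S) fun t ht => ?_
    rw [← neg_mul]
    have h1 : -(V t).re ≤ ‖V t‖ := (neg_le_abs _).trans (Complex.abs_re_le_norm _)
    exact (mul_le_mul_of_nonneg_right h1 (by positivity)).trans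
      (mul_le_mul_of_nonneg_left (hS t ht) (norm_nonneg _))
  linarith

end Edge

/-! ### Coercivity far out on the negative real axis -/

variable {ι : Type} [Fintype ι] [DecidableEq ι] {G : StarGraph ι} {Γ : BoundaryConditions ι}

/-- At `z = -r` a homogeneous solution has energy `∫ |u'|² + r ∫ |u|²` bounded by the potential and
boundary terms, and both are controlled by suprema of `|u|²`. The Sobolev inequality absorbs these
suprema when `r` is large, so the solution vanishes. -/
lemma exists_evans_ne_zero (hG : G.IsRegular) (hΓ : Γ.IsSelfAdjoint) :
    ∃ z, evans G Γ G.inner z ≠ 0 := by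
  obtain ⟨Ca, hCa, ha⟩ := exists_norm_star_dotProduct_le hΓ.comm_α
  obtain ⟨Cb, hCb, hb⟩ := exists_norm_star_dotProduct_le hΓ.comm_β
  set v : ι → ℝ := fun k => ∫ t in G.inner k..G.outer k, ‖G.potential k t‖
  have hv : ∀ k, 0 ≤ v k := fun k =>
    intervalIntegral.integral_nonneg (hG.lt k).le fun _ _ => norm_nonneg _
  -- `K` collects the coefficients of all terms bounded by the suprema; the summand `1` only makes
  -- it positive.
  set K : ℝ := Ca + Cb + ∑ k, v k + 1 with hK
  have hKpos : 0 < K := by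
    have : 0 ≤ ∑ k, v k := Finset.sum_nonneg fun k _ => hv k
    positivity
  set L : ℝ := ∑ k, 1 / (G.outer k - G.inner k)
  have hL : ∀ k, 1 / (G.outer k - G.inner k) ≤ L := fun k =>
    Finset.single_le_sum (f := fun k => 1 / (G.outer k - G.inner k))
      (fun k _ => (one_div_pos.2 (sub_pos.2 (hG.lt k))).le) (Finset.mem_univ k)
  -- With `ε = 1 / (2 * K)` in the Sobolev inequality, `K` times the supremum bound costs half of `∫
  -- |u'|²` and `K * (2 * K + L)` times `∫ |u|²`. This `r` exceeds the latter coefficient by one.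
  set r : ℝ := K * (2 * K + L) + 1 with hr
  refine ⟨-(r : ℂ), fun hE => ?_⟩
  obtain ⟨u, u', hu, hne⟩ := exists_isBVPSolution_zero_of_evans_eq_zero hG hΓ hE
  obtain ⟨⟨d, d1, d2⟩, c, c1, c2⟩ := (trace_eq_zero_iff hΓ).1 hu.2
  set A : ι → ℝ := fun k => ∫ t in G.inner k..G.outer k, ‖u' k t‖ ^ 2
  set B : ι → ℝ := fun k => ∫ t in G.inner k..G.outer k, ‖u k t‖ ^ 2
  have hA : ∀ k, 0 ≤ A k := fun k =>
    intervalIntegral.integral_nonneg (hG.lt k).le fun _ _ => by positivity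
  have hB : ∀ k, 0 ≤ B k := fun k =>
    intervalIntegral.integral_nonneg (hG.lt k).le fun _ _ => by positivity
  set S : ι → ℝ := fun k => 1 / (2 * K) * A k + (2 * K + L) * B k
  have hS : ∀ k, ∀ x ∈ Icc (G.inner k) (G.outer k), ‖u k x‖ ^ 2 ≤ S k := by
    intro k x hx
    refine ((hu.1 k).norm_sq_le (hG.lt k) (ε := 1 / (2 * K)) (by positivity) hx).trans ?_
    rw [one_div_one_div]
    have := mul_le_mul_of_nonneg_right (hL k) (hB k)
    simp only [S]
    linarith
  have hS0 : ∀ k, 0 ≤ S k := fun k => (by positivity : (0 : ℝ) ≤ _).trans (hS k _ (hG.left_mem k))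
  have hbd : ∀ k, A k + r * B k ≤ v k * S k +
      (star (u k (G.outer k)) * u' k (G.outer k) - star (u k (G.inner k)) * u' k (G.inner k)).re :=
    fun k => (hu.1 k).energy_le (hG.lt k).le (hG.integrableOn k) (hS k)
  have hsum := Finset.sum_le_sum fun k (_ : k ∈ Finset.univ) => hbd k
  rw [Finset.sum_add_distrib, Finset.sum_add_distrib, ← Finset.mul_sum, ← Complex.re_sum,
    Finset.sum_sub_distrib, Complex.sub_re] at hsum
  have hba : -(∑ k, star (u k (G.inner k)) * u' k (G.inner k)).re ≤ Ca * ∑ k, S k := by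
    refine (neg_le_abs _).trans ((Complex.abs_re_le_norm _).trans ?_)
    have h1 := ha c
    simp only [dotProduct, Pi.star_apply, ← c1, ← c2] at h1
    refine h1.trans (mul_le_mul_of_nonneg_left (Finset.sum_le_sum fun k _ => ?_) hCa)
    exact hS k _ (hG.left_mem k)
  have hbb : (∑ k, star (u k (G.outer k)) * u' k (G.outer k)).re ≤ Cb * ∑ k, S k := by
    refine (le_abs_self _).trans ((Complex.abs_re_le_norm _).trans ?_)
    have h1 := hb d
    simp only [dotProduct, Pi.star_apply, ← d1, ← d2] at h1
    refine h1.trans (mul_le_mul_of_nonneg_left (Finset.sum_le_sum fun k _ => ?_) hCb)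
    exact hS k _ (hG.right_mem k)
  have hvS : ∑ k, v k * S k ≤ (∑ k, v k) * ∑ k, S k := by
    rw [Finset.sum_mul]
    refine Finset.sum_le_sum fun k _ => mul_le_mul_of_nonneg_left ?_ (hv k)
    exact Finset.single_le_sum (f := S) (fun k _ => hS0 k) (Finset.mem_univ k)
  have hSsum : ∑ k, S k = 1 / (2 * K) * ∑ k, A k + (2 * K + L) * ∑ k, B k := by
    rw [Finset.mul_sum, Finset.mul_sum, ← Finset.sum_add_distrib]
  have hSs0 : 0 ≤ ∑ k, S k := Finset.sum_nonneg fun k _ => hS0 k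
  have htot : ∑ k, A k + r * ∑ k, B k ≤ K * ∑ k, S k := by
    have : K * ∑ k, S k = Ca * ∑ k, S k + Cb * ∑ k, S k + (∑ k, v k) * ∑ k, S k + ∑ k, S k := by
      rw [hK]; ring
    linarith
  have hA0 : 0 ≤ ∑ k, A k := Finset.sum_nonneg fun k _ => hA k
  have hB0 : 0 ≤ ∑ k, B k := Finset.sum_nonneg fun k _ => hB k
  have hK2 : K * ∑ k, S k = 1 / 2 * ∑ k, A k + K * (2 * K + L) * ∑ k, B k := by
    rw [hSsum]; field_simp
  have hz : 1 / 2 * ∑ k, A k + ∑ k, B k ≤ 0 := by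
    rw [hK2, hr] at htot
    linarith
  have hzS : ∑ k, S k = 0 := by
    have h1 : ∑ k, A k = 0 := by linarith
    have h2 : ∑ k, B k = 0 := by linarith
    rw [hSsum, h1, h2]; ring
  refine hne fun k => ?_
  have hk : S k = 0 := (Finset.sum_eq_zero_iff_of_nonneg fun k _ => hS0 k).1 hzS k (Finset.mem_univ k)
  have hu0 : ∀ x ∈ Icc (G.inner k) (G.outer k), u k x = 0 := fun x hx => by
    have := hS k x hx
    rw [hk] at this
    exact norm_eq_zero.1 (pow_eq_zero_iff two_ne_zero |>.1 (le_antisymm this (by positivity)))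
  exact fun x hx => ⟨hu0 x hx, (hu.1 k).deriv_eq_zero (hG.lt k) hu0 x hx⟩

end

noncomputable section

/-! ### The resolvent set -/

section Edge

variable {a b : ℝ}

lemma integrableOn_Lp (f : Lp ℂ 2 (volume.restrict (Ioo a b))) : IntegrableOn f (Ioo a b) :=
  (Lp.memLp f).integrable (by norm_num)

/-- The embedding of `C([a,b])` in `L²(a,b)`. -/
def continuousToLp (hab : a ≤ b) : C(Icc a b, ℂ) →L[ℂ] Lp ℂ 2 (volume.restrict (Ioo a b)) :=
  have hm : ∀ w : C(Icc a b, ℂ), MemLp (IccExtend hab w) 2 (volume.restrict (Ioo a b)) := fun w =>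
    MemLp.of_bound (w.continuous.Icc_extend' (h := hab)).aestronglyMeasurable ‖w‖
      (Eventually.of_forall fun _ => w.norm_coe_le_norm _)
  LinearMap.mkContinuousOfExistsBound
    { toFun := fun w => (hm w).toLp
      map_add' := fun _ _ => rfl
      map_smul' := fun _ _ => rfl }
    ⟨_, fun w => Lp.norm_le_of_ae_bound (norm_nonneg w) (by
      filter_upwards [(hm w).coeFn_toLp] with x hx
      exact (congrArg norm hx).trans_le (w.norm_coe_le_norm _))⟩

lemma continuousToLp_ae (hab : a ≤ b) (w : C(Icc a b, ℂ)) :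
    continuousToLp hab w =ᵐ[volume.restrict (Ioo a b)] IccExtend hab w :=
  MemLp.coeFn_toLp (MemLp.of_bound (w.continuous.Icc_extend' (h := hab)).aestronglyMeasurable ‖w‖
      (Eventually.of_forall fun _ => w.norm_coe_le_norm _))

lemma exists_Lp_ae_eq (hab : a ≤ b) {u : ℝ → ℂ} (hu : ContinuousOn u (Icc a b)) :
    ∃ φ : Lp ℂ 2 (volume.restrict (Ioo a b)), φ =ᵐ[volume.restrict (Ioo a b)] u := by
  let w : C(Icc a b, ℂ) := ⟨fun x => u x, continuousOn_iff_continuous_domRestrict.1 hu⟩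
  refine ⟨continuousToLp hab w, (continuousToLp_ae hab w).trans ?_⟩
  rw [EventuallyEq, ae_restrict_iff' measurableSet_Ioo]
  refine Eventually.of_forall fun x hx => ?_
  rw [IccExtend_of_mem _ _ (Ioo_subset_Icc_self hx)]
  rfl

/-- The primitive of a function in `L²(a,b)`. -/
def primitiveLp (hab : a ≤ b) : Lp ℂ 2 (volume.restrict (Ioo a b)) →L[ℂ] C(Icc a b, ℂ) :=
  LinearMap.mkContinuousOfExistsBound
    { toFun := fun f => primitiveOp hab f (integrableOn_Lp f) 1
      map_add' := fun f g => by
        ext x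
        simp only [ContinuousMap.add_apply, primitiveOp_apply]
        simp only [IccExtend, Function.comp_apply, ContinuousMap.one_apply, mul_one]
        rw [← intervalIntegral.integral_add (intervalIntegrable_of_mem (integrableOn_Lp f) x.2)
          (intervalIntegrable_of_mem (integrableOn_Lp g) x.2),
          intervalIntegral.integral_of_le x.2.1, intervalIntegral.integral_of_le x.2.1,
          integral_Ioc_eq_integral_Ioo, integral_Ioc_eq_integral_Ioo]
        exact integral_congr_ae (ae_restrict_of_ae_restrict_of_subset
          (Ioo_subset_Ioo_right x.2.2) (Lp.coeFn_add f g))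
      map_smul' := fun c f => by
        ext x
        simp only [ContinuousMap.smul_apply, primitiveOp_apply, RingHom.id_apply]
        simp only [IccExtend, Function.comp_apply, ContinuousMap.one_apply, mul_one]
        rw [← intervalIntegral.integral_smul,
          intervalIntegral.integral_of_le x.2.1, intervalIntegral.integral_of_le x.2.1,
          integral_Ioc_eq_integral_Ioo, integral_Ioc_eq_integral_Ioo]
        exact integral_congr_ae (ae_restrict_of_ae_restrict_of_subset
          (Ioo_subset_Ioo_right x.2.2) (Lp.coeFn_smul c f)) }
    -- The constant of the Hölder embedding of `L²` in `L¹` on a bounded interval, the square root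
    -- of its length.
    ⟨((volume.restrict (Ioo a b)) univ ^ (1 / (1 : ENNReal).toReal - 1 / (2 : ENNReal).toReal)).toReal,
      fun f => by
      rw [ContinuousMap.norm_le _ (by positivity)]
      intro x
      have hi := integrableOn_Lp f
      change ‖∫ t in a..x, f t * IccExtend hab (1 : C(Icc a b, ℂ)) t‖ ≤ _
      simp only [IccExtend, Function.comp_apply, ContinuousMap.one_apply, mul_one]
      calc ‖∫ t in a..x, f t‖ ≤ ∫ t in a..x, ‖f t‖ :=
            intervalIntegral.norm_integral_le_integral_norm x.2.1
        _ ≤ ∫ t in a..b, ‖f t‖ := intervalIntegral.integral_mono_interval le_rfl x.2.1 x.2.2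
            (Eventually.of_forall fun t => norm_nonneg _)
            (intervalIntegrable_of_mem hi (right_mem_Icc.2 hab)).norm
        _ = (eLpNorm f 1 (volume.restrict (Ioo a b))).toReal := by
            rw [intervalIntegral.integral_of_le hab, integral_Ioc_eq_integral_Ioo,
              integral_norm_eq_lintegral_enorm hi.aestronglyMeasurable, eLpNorm_one_eq_lintegral_enorm]
        _ ≤ _ := by
            rw [Lp.norm_def, mul_comm, ← ENNReal.toReal_mul]
            refine ENNReal.toReal_mono ?_
              (eLpNorm_le_eLpNorm_mul_rpow_measure_univ (by norm_num) hi.aestronglyMeasurable)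
            refine ENNReal.mul_ne_top (Lp.eLpNorm_ne_top f)
              (ENNReal.rpow_ne_top_of_nonneg (by norm_num) (measure_ne_top _ _))⟩

/-- The solution operator of the inhomogeneous initial value problem with vanishing data at the
left end point. -/
lemma exists_inhomogeneousOp (hab : a < b) {V : ℝ → ℂ} (hV : IntegrableOn V (Ioo a b)) (z : ℂ) :
    ∃ P : Lp ℂ 2 (volume.restrict (Ioo a b)) →L[ℂ] PhaseSpace a b, ∀ f,
      IsW21 a b (IccExtend hab.le (P f).1) (IccExtend hab.le (P f).2)
        (fun x => (V x - z) * IccExtend hab.le (P f).1 x - f x) := by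
  refine ⟨(solutionOp hab.le V hV z).comp
    ((0 : Lp ℂ 2 (volume.restrict (Ioo a b)) →L[ℂ] C(Icc a b, ℂ)).prod (-primitiveLp hab.le)),
    fun f => (isW21_solutionOp hab hV z 0 0 (integrableOn_Lp f) _ ?_).1⟩
  rw [ContinuousLinearMap.comp_apply]
  congr 1
  refine Prod.ext ?_ ?_
  · rfl
  · change -primitiveLp hab.le f = ContinuousMap.const _ 0 - _
    rw [← zero_sub]
    rfl

lemma IsW21.congr_second_ae {u u' u'' w'' : ℝ → ℂ} (h : IsW21 a b u u' u'')
    (e : u'' =ᵐ[volume.restrict (Ioo a b)] w'') : IsW21 a b u u' w'' where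
  integrableOn := h.integrableOn.congr_fun_ae e
  hasDeriv := h.hasDeriv
  integral_eq x hx := by
    rw [h.integral_eq x hx]
    congr 1
    rw [intervalIntegral.integral_of_le hx.1, intervalIntegral.integral_of_le hx.1,
      integral_Ioc_eq_integral_Ioo, integral_Ioc_eq_integral_Ioo]
    exact integral_congr_ae
      (ae_restrict_of_ae_restrict_of_subset (Ioo_subset_Ioo_right hx.2) e)

lemma IsW21.eq_zero_of_ae (hab : a < b) {u u' u'' : ℝ → ℂ} (h : IsW21 a b u u' u'')
    (e : u =ᵐ[volume.restrict (Ioo a b)] 0) : ∀ x ∈ Icc a b, u x = 0 ∧ u' x = 0 := by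
  have h0 : EqOn u 0 (Icc a b) := by
    refine Measure.eqOn_Icc_of_ae_eq volume hab.ne ?_ h.continuousOn continuousOn_const
    rwa [← Measure.restrict_congr_set (Ioo_ae_eq_Icc (μ := volume) (a := a) (b := b))]
  exact fun x hx => ⟨h0 hx, h.deriv_eq_zero hab h0 x hx⟩

end Edge

/-! ### Resolvent sets in terms of operator graphs -/

section Abstract

variable {E : Type} [NormedAddCommGroup E] [NormedSpace ℂ E] {A : E →ₗ.[ℂ] E} {z : ℂ}

/-- A right inverse of `A - z` is also a left inverse once `A - z` is injective: `R (A u - z u) - u`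
is annihilated by `A - z`. -/
lemma mem_operatorResolventSet_of_graph (R : E →L[ℂ] E) (hR : ∀ v, (R v, v + z • R v) ∈ A.graph)
    (hA : ∀ u, (u, z • u) ∈ A.graph → u = 0) : z ∈ operatorResolventSet A := by
  have h1 : ∀ v, ∃ h : R v ∈ A.domain, A ⟨R v, h⟩ - z • R v = v := by
    intro v
    obtain ⟨y, hy, hy'⟩ := (LinearPMap.mem_graph_iff A).1 (hR v)
    obtain ⟨y, hyd⟩ := y
    simp only at hy hy'
    subst hy
    exact ⟨hyd, by rw [hy', add_sub_cancel_right]⟩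
  refine ⟨R, h1, fun u => ?_⟩
  have hg := A.graph.sub_mem (hR (A u - z • (u : E))) (A.mem_graph u)
  rw [← sub_eq_zero]
  refine hA _ ?_
  convert! hg using 1
  refine Prod.ext rfl ?_
  simp only [Prod.snd_sub, smul_sub]
  abel

lemma eq_zero_of_mem_operatorResolventSet (hz : z ∈ operatorResolventSet A) {u : E}
    (hu : (u, z • u) ∈ A.graph) : u = 0 := by
  obtain ⟨R, -, hR⟩ := hz
  obtain ⟨y, hy, hy'⟩ := (LinearPMap.mem_graph_iff A).1 hu
  have := hR y
  simp only at hy hy'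
  rw [hy', hy, sub_self, map_zero] at this
  exact this.symm

end Abstract

/-! ### The resolvent set as the complement of the zeros of the Evans function -/

variable {ι : Type} [Fintype ι] [DecidableEq ι] {G : StarGraph ι} {Γ : BoundaryConditions ι} {z : ℂ}

lemma eq_zero_of_mem_graph (hG : G.IsRegular) (hΓ : Γ.IsSelfAdjoint)
    (hE : evans G Γ G.inner z ≠ 0) {φ : L2 G} (hφ : (φ, z • φ) ∈ (schrodinger G Γ).graph) :
    φ = 0 := by
  rw [schrodinger_graph] at hφ
  obtain ⟨u, u', u'', hu, h1, h2, ht⟩ := hφ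
  have hb : IsBVPSolution G Γ z 0 u u' := by
    refine ⟨fun i => (hu i).congr_second_ae ?_, ht⟩
    filter_upwards [h1 i, h2 i, Lp.coeFn_smul z (φ i)] with x e1 e2 e3
    have e4 : z * u i x = -u'' i x + G.potential i x * u i x := by
      rw [← e2, ← e1]
      exact e3.symm
    linear_combination e4
  ext i : 1
  refine Lp.ext ((h1 i).trans (EventuallyEq.trans ?_ (Lp.coeFn_zero ℂ 2 _).symm))
  rw [EventuallyEq, ae_restrict_iff' measurableSet_Ioo]
  exact Eventually.of_forall fun x hx => (hb.eq_zero hG hΓ hE i x (Ioo_subset_Icc_self hx)).1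

lemma evans_ne_zero_of_mem_resolventSet (hG : G.IsRegular) (hΓ : Γ.IsSelfAdjoint)
    (hz : z ∈ operatorResolventSet (schrodinger G Γ)) : evans G Γ G.inner z ≠ 0 := by
  intro hE
  obtain ⟨u, u', hu, hne⟩ := exists_isBVPSolution_zero_of_evans_eq_zero hG hΓ hE
  choose φ hφ using fun i => exists_Lp_ae_eq (hG.lt i).le (hu.1 i).continuousOn
  have h0 : (WithLp.toLp 2 φ : L2 G) = 0 := by
    refine eq_zero_of_mem_operatorResolventSet hz ?_
    rw [schrodinger_graph]
    refine ⟨u, u', _, hu.1, hφ, fun i => ?_, hu.2⟩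
    refine (Lp.coeFn_smul z (φ i)).trans ?_
    filter_upwards [hφ i] with x e1
    rw [Pi.smul_apply, e1, smul_eq_mul]
    ring
  refine hne fun i => (hu.1 i).eq_zero_of_ae (hG.lt i) ((hφ i).symm.trans ?_)
  have hi : φ i = 0 := congrFun (congrArg WithLp.ofLp h0) i
  rw [hi]
  exact Lp.coeFn_zero ℂ 2 _

/-- The resolvent is a particular solution with zero data at the central vertex plus a homogeneous
solution whose trace cancels that of the first. The correction has finite rank, so boundedness comes
from that of the Volterra solution operator. -/
lemma mem_resolventSet_of_evans_ne_zero (hG : G.IsRegular) (hΓ : Γ.IsSelfAdjoint)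
    (hE : evans G Γ G.inner z ≠ 0) : z ∈ operatorResolventSet (schrodinger G Γ) := by
  choose P hP using fun i => exists_inhomogeneousOp (hG.lt i) (hG.integrableOn i) z
  let p : L2 G → ι → ℝ → ℂ := fun f i => IccExtend (hG.lt i).le (P i (f i)).1
  let p' : L2 G → ι → ℝ → ℂ := fun f i => IccExtend (hG.lt i).le (P i (f i)).2
  have hcont : ∀ i x, Continuous (fun f => p f i x) ∧ Continuous (fun f => p' f i x) := by
    intro i x
    have h1 : Continuous fun f : L2 G => P i (f i) := (P i).continuous.comp (by fun_prop)
    exact ⟨(continuous_eval_const _).comp (continuous_fst.comp h1),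
      (continuous_eval_const _).comp (continuous_snd.comp h1)⟩
  have hpadd : ∀ f g, p (f + g) = p f + p g ∧ p' (f + g) = p' f + p' g := by
    intro f g
    constructor <;> ext i x <;> simp [p, p', IccExtend]
  have hpsmul : ∀ (c : ℂ) f, p (c • f) = c • p f ∧ p' (c • f) = c • p' f := by
    intro c f
    constructor <;> ext i x <;> simp [p, p', IccExtend]
  let τ : L2 G →L[ℂ] (ι ⊕ ι → ℂ) :=
    { toFun := fun f => trace G Γ (p f) (p' f)
      map_add' := fun f g => by rw [(hpadd f g).1, (hpadd f g).2, trace_add]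
      map_smul' := fun c f => by rw [(hpsmul c f).1, (hpsmul c f).2, trace_smul, RingHom.id_apply]
      cont := by
        refine continuous_pi fun i => ?_
        rcases i with i | i <;>
          simp only [trace, Sum.elim_inl, Sum.elim_inr, Pi.add_apply, Matrix.mulVec, dotProduct]
        · exact (continuous_finsetSum _ fun k _ => continuous_const.mul (hcont k _).1).add
            (continuous_finsetSum _ fun k _ => continuous_const.mul (hcont k _).2)
        · exact (continuous_finsetSum _ fun k _ => continuous_const.mul (hcont k _).1).add
            (continuous_finsetSum _ fun k _ => continuous_const.mul (hcont k _).2) }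
  let T := LinearEquiv.ofInjectiveEndo (traceMap G Γ z) (traceMap_injective hG hΓ hE)
  let e : L2 G →L[ℂ] (ι ⊕ ι → ℂ) := (-(T.symm : (ι ⊕ ι → ℂ) →ₗ[ℂ] _).toContinuousLinearMap).comp τ
  have he : ∀ f, traceMap G Γ z (e f) = -τ f := by
    intro f
    have h1 : e f = -T.symm (τ f) := rfl
    rw [h1, map_neg]
    exact congrArg Neg.neg (T.apply_symm_apply (τ f))
  -- The `L²` classes of the fundamental solutions do not depend on `f`; the correction depends on
  -- `f` only through the coefficients `e f`, which makes `R` visibly linear and continuous.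
  choose θ hθ using fun i => exists_Lp_ae_eq (hG.lt i).le
    (isIVPSolution_left (hG.lt i) (hG.integrableOn i) z 1 0).1.continuousOn
  choose φ hφ using fun i => exists_Lp_ae_eq (hG.lt i).le
    (isIVPSolution_left (hG.lt i) (hG.integrableOn i) z 0 1).1.continuousOn
  let R : L2 G →L[ℂ] L2 G :=
    { toFun := fun f => WithLp.toLp 2 fun i => continuousToLp (hG.lt i).le (P i (f i)).1 +
        (e f (Sum.inl i) • θ i + e f (Sum.inr i) • φ i)
      map_add' := fun f g => by
        ext i : 1
        simp only [PiLp.add_apply, map_add, Prod.fst_add, Pi.add_apply, add_smul]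
        abel
      map_smul' := fun c f => by
        ext i : 1
        simp only [PiLp.smul_apply, map_smul, Prod.smul_fst, Pi.smul_apply, RingHom.id_apply,
          smul_add, smul_assoc]
      cont := by
        refine (PiLp.continuous_toLp 2 _).comp (continuous_pi fun i => ?_)
        have h1 : Continuous fun f : L2 G => P i (f i) := (P i).continuous.comp (by fun_prop)
        refine ((continuousToLp (hG.lt i).le).continuous.comp (continuous_fst.comp h1)).add ?_
        exact (((continuous_apply _).comp e.continuous).smul continuous_const).add
          (((continuous_apply _).comp e.continuous).smul continuous_const) }
  refine mem_operatorResolventSet_of_graph R (fun f => ?_) fun φ hφ =>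
    eq_zero_of_mem_graph hG hΓ hE hφ
  rw [schrodinger_graph]
  have hR : ∀ i, R f i =ᵐ[volume.restrict (Ioo (G.inner i) (G.outer i))]
      (p f + fun k => (initialSolution G z (e f) k).1) i := by
    intro i
    have h1 : R f i = continuousToLp (hG.lt i).le (P i (f i)).1 +
      (e f (Sum.inl i) • θ i + e f (Sum.inr i) • φ i) := rfl
    rw [h1]
    filter_upwards [Lp.coeFn_add (continuousToLp (hG.lt i).le (P i (f i)).1)
      (e f (Sum.inl i) • θ i + e f (Sum.inr i) • φ i), continuousToLp_ae (hG.lt i).le (P i (f i)).1,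
      Lp.coeFn_add (e f (Sum.inl i) • θ i) (e f (Sum.inr i) • φ i),
      Lp.coeFn_smul (e f (Sum.inl i)) (θ i), Lp.coeFn_smul (e f (Sum.inr i)) (φ i), hθ i, hφ i]
      with x e1 e2 e3 e4 e5 e6 e7
    rw [e1, Pi.add_apply, e2, e3, Pi.add_apply, e4, e5, Pi.smul_apply, Pi.smul_apply, e6, e7]
    simp [initialSolution, p]
  refine ⟨p f + fun k => (initialSolution G z (e f) k).1,
    p' f + fun k => (initialSolution G z (e f) k).2, _,
    fun i => IsW21.add (hP i (f i)) (isIVPSolution_initialSolution hG z (e f) i).1, hR,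
    fun i => ?_, ?_⟩
  · refine (Lp.coeFn_add (f i) (z • R f i)).trans ?_
    filter_upwards [Lp.coeFn_smul z (R f i), hR i] with x e1 e2
    rw [Pi.add_apply, e1, Pi.smul_apply, e2, smul_eq_mul]
    simp only [Pi.add_apply, p]
    ring
  · rw [trace_add]
    change τ f + traceMap G Γ z (e f) = 0
    rw [he, add_neg_cancel]

lemma mem_resolventSet_iff (hG : G.IsRegular) (hΓ : Γ.IsSelfAdjoint) :
    z ∈ operatorResolventSet (schrodinger G Γ) ↔ evans G Γ G.inner z ≠ 0 :=
  ⟨evans_ne_zero_of_mem_resolventSet hG hΓ, mem_resolventSet_of_evans_ne_zero hG hΓ⟩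

/-- The Evans function is entire and not identically zero, so its zeros are isolated. -/
lemma resolventSet_mem_codiscrete (hG : G.IsRegular) (hΓ : Γ.IsSelfAdjoint) :
    operatorResolventSet (schrodinger G Γ) ∈ codiscrete ℂ := by
  obtain ⟨z, hz⟩ := exists_evans_ne_zero hG hΓ
  have hd := differentiable_evans hG Γ (x := G.inner) fun i => hG.left_mem i
  have := AnalyticOnNhd.preimage_zero_mem_codiscrete (fun w _ => hd.analyticAt w) hz
  filter_upwards [this] with w hw
  exact (mem_resolventSet_iff hG hΓ).2 hw

end

noncomputable section

/-! ### Splitting a star graph -/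

section Diagonal

open Matrix

variable {ι : Type} [Fintype ι] [DecidableEq ι]

open scoped ComplexOrder in
lemma rank_fromCols_diagonal {p q : ι → ℂ} (h : ∀ i, p i = 0 → q i ≠ 0) :
    (fromCols (Matrix.diagonal p) (Matrix.diagonal q)).rank = Fintype.card ι := by
  rw [← rank_conjTranspose, rank_eq_finrank_span_cols, ← Set.finrank, eq_comm,
    ← linearIndependent_iff_card_eq_finrank_span]
  refine mulVec_injective_iff.1 ?_
  rw [← Matrix.coe_mulVecLin, ← LinearMap.ker_eq_bot, LinearMap.ker_eq_bot']
  intro c hc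
  rw [Matrix.mulVecLin_apply, conjTranspose_fromCols_eq_fromRows_conjTranspose, fromRows_mulVec,
    diagonal_conjTranspose, diagonal_conjTranspose] at hc
  ext i
  have h1 := congrFun hc (Sum.inl i)
  have h2 := congrFun hc (Sum.inr i)
  simp only [Sum.elim_inl, Sum.elim_inr, mulVec_diagonal, Pi.star_apply, Pi.zero_apply,
    mul_eq_zero, star_eq_zero] at h1 h2
  rcases h1 with h1 | h1
  · exact h2.resolve_left (h i h1)
  · exact h1

lemma diagonal_mul_conjTranspose_comm {p q : ι → ℂ} (h : ∀ i, p i * star (q i) = q i * star (p i)) :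
    Matrix.diagonal p * (Matrix.diagonal q)ᴴ = Matrix.diagonal q * (Matrix.diagonal p)ᴴ := by
  rw [diagonal_conjTranspose, diagonal_conjTranspose, diagonal_mul_diagonal, diagonal_mul_diagonal]
  exact congrArg _ (funext h)

end Diagonal

variable {ι : Type} [Fintype ι] [DecidableEq ι] {G : StarGraph ι} {Γ : BoundaryConditions ι}
  {j : ι} {s : ℝ} {z : ℂ}

lemma BoundaryConditions.IsSelfAdjoint.diagonal_β (hΓ : Γ.IsSelfAdjoint) :
    Matrix.diagonal Γ.β₁.diag = Γ.β₁ ∧ Matrix.diagonal Γ.β₂.diag = Γ.β₂ :=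
  ⟨hΓ.diag_β₁.diagonal_diag, hΓ.diag_β₂.diagonal_diag⟩

/-- If both diagonal entries vanished, the `i`-th unit vector would be annihilated by `β₁*` and
`β₂*`, against the rank condition. -/
lemma BoundaryConditions.IsSelfAdjoint.β_ne_zero (hΓ : Γ.IsSelfAdjoint) (i : ι)
    (h : Γ.β₁ i i = 0) : Γ.β₂ i i ≠ 0 := by
  intro h'
  have := eq_zero_of_conjTranspose_mulVec hΓ.rank_β (c := Pi.single i 1)
    (by
      rw [← hΓ.diagonal_β.2, Matrix.diagonal_conjTranspose, Matrix.neg_mulVec, neg_eq_zero]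
      ext k
      rw [Matrix.mulVec_diagonal]
      rcases eq_or_ne k i with rfl | hk
      · simp [h']
      · simp [hk])
    (by
      rw [← hΓ.diagonal_β.1, Matrix.diagonal_conjTranspose]
      ext k
      rw [Matrix.mulVec_diagonal]
      rcases eq_or_ne k i with rfl | hk
      · simp [h]
      · simp [hk])
  simpa using congrFun this i

lemma BoundaryConditions.IsSelfAdjoint.β_comm (hΓ : Γ.IsSelfAdjoint) (i : ι) :
    Γ.β₁ i i * star (Γ.β₂ i i) = Γ.β₂ i i * star (Γ.β₁ i i) := by
  have h := hΓ.comm_β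
  rw [← hΓ.diagonal_β.1, ← hΓ.diagonal_β.2, Matrix.diagonal_conjTranspose,
    Matrix.diagonal_conjTranspose, Matrix.diagonal_mul_diagonal, Matrix.diagonal_mul_diagonal] at h
  exact congrFun (Matrix.diagonal_injective h) i

lemma isSelfAdjoint_outerConditions (hΓ : Γ.IsSelfAdjoint) (j : ι) :
    (outerConditions Γ j).IsSelfAdjoint where
  rank_α := by
    have := rank_fromCols_diagonal (ι := Fin 1) (p := fun _ => 1) (q := fun _ => 0) (by simp)
    rwa [Matrix.diagonal_one, Matrix.diagonal_zero] at this
  rank_β := rank_fromCols_diagonal fun _ => hΓ.β_ne_zero j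
  comm_α := by simp [outerConditions]
  comm_β := diagonal_mul_conjTranspose_comm fun _ => hΓ.β_comm j
  diag_β₁ := Matrix.isDiag_diagonal _
  diag_β₂ := Matrix.isDiag_diagonal _

lemma isSelfAdjoint_innerConditions (hΓ : Γ.IsSelfAdjoint) (j : ι) :
    (innerConditions Γ j).IsSelfAdjoint where
  rank_α := hΓ.rank_α
  rank_β := rank_fromCols_diagonal fun i => by
    rcases eq_or_ne i j with rfl | h
    · simp
    · simpa [h] using hΓ.β_ne_zero i
  comm_α := hΓ.comm_α
  comm_β := diagonal_mul_conjTranspose_comm fun i => by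
    rcases eq_or_ne i j with rfl | h
    · simp
    · simpa [h] using hΓ.β_comm i
  diag_β₁ := Matrix.isDiag_diagonal _
  diag_β₂ := Matrix.isDiag_diagonal _

lemma isRegular_outerGraph {ι : Type} {G : StarGraph ι} {j : ι} {s : ℝ} (hG : G.IsRegular) (hs : s ∈ Ioo (G.inner j) (G.outer j)) :
    (outerGraph G j s).IsRegular where
  lt _ := hs.2
  integrableOn _ := (hG.integrableOn j).mono_set (Ioo_subset_Ioo_left hs.1.le)

lemma isRegular_innerGraph {ι : Type} [DecidableEq ι] {G : StarGraph ι} {j : ι} {s : ℝ}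
    (hG : G.IsRegular) (hs : s ∈ Ioo (G.inner j) (G.outer j)) :
    (innerGraph G j s).IsRegular where
  lt i := by
    rcases eq_or_ne i j with rfl | h
    · simpa [innerGraph] using hs.1
    · simpa [innerGraph, h] using hG.lt i
  integrableOn i := by
    rcases eq_or_ne i j with rfl | h
    · simpa [innerGraph] using (hG.integrableOn i).mono_set (Ioo_subset_Ioo_right hs.2.le)
    · simpa [innerGraph, h] using hG.integrableOn i

lemma isPoint_innerGraph_outer {ι : Type} [DecidableEq ι] {G : StarGraph ι} {j : ι} {s : ℝ}
    (hG : G.IsRegular) (hs : s ∈ Ioo (G.inner j) (G.outer j)) :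
    IsPoint G (innerGraph G j s).outer := fun i => by
  rcases eq_or_ne i j with rfl | h
  · simpa [innerGraph] using Ioo_subset_Icc_self hs
  · simpa [innerGraph, h] using hG.right_mem i

/-- The column of `Z` that belongs to the outer vertex of edge `j` restricts to the outer piece. -/
lemma solZ_outerGraph {ι : Type} {G : StarGraph ι} {j : ι} {s : ℝ} (hG : G.IsRegular)
    (hs : s ∈ Ioo (G.inner j) (G.outer j))
    (Γ : BoundaryConditions ι) (z : ℂ) :
    ∀ x ∈ Icc s (G.outer j),
      (solZ (outerGraph G j s) (outerConditions Γ j) z 0 0).1 x = (solZ G Γ z j j).1 x ∧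
      (solZ (outerGraph G j s) (outerConditions Γ j) z 0 0).2 x = (solZ G Γ z j j).2 x := by
  have hR := isRegular_outerGraph hG hs
  obtain ⟨h, h1, h2⟩ := isIVPSolution_ivpSolution (hG.lt j) (hG.integrableOn j) z
    ((-Γ.β₂.conjTranspose) j j) (Γ.β₁.conjTranspose j j) (hG.right_mem j)
  have k := isIVPSolution_ivpSolution (hR.lt 0) (hR.integrableOn 0) z
    ((-(outerConditions Γ j).β₂.conjTranspose) 0 0) ((outerConditions Γ j).β₁.conjTranspose 0 0)
    (hR.right_mem 0)
  refine k.eq_of_eq (hR.lt 0) (hR.integrableOn 0) (hR.right_mem 0)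
    ⟨h.restrict (Ioo_subset_Icc_self hs) le_rfl, ?_, ?_⟩
  · exact h1.trans (by simp [outerConditions])
  · exact h2.trans (by simp [outerConditions])

/-- At `s` the Dirichlet condition gives `Y = 0` and `Y' = 1`, so the determinant is `0 * ζ'(s) -
ζ(s) * 1`, with `ζ = z_j` on edge `j`. -/
lemma evans_outerGraph {ι : Type} {G : StarGraph ι} {j : ι} {s : ℝ} (hG : G.IsRegular)
    (hs : s ∈ Ioo (G.inner j) (G.outer j))
    (Γ : BoundaryConditions ι) (z : ℂ) :
    evans (outerGraph G j s) (outerConditions Γ j) (outerGraph G j s).inner z =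
      -(solZ G Γ z j j).1 s := by
  have hR := isRegular_outerGraph hG hs
  obtain ⟨-, h1, h2⟩ := isIVPSolution_ivpSolution (hR.lt 0) (hR.integrableOn 0) z
    ((-(outerConditions Γ j).α₂.conjTranspose) 0 0) ((outerConditions Γ j).α₁.conjTranspose 0 0)
    (hR.left_mem 0)
  have hZ := solZ_outerGraph hG hs Γ z s (left_mem_Icc.2 hs.2.le)
  have hM : fundamentalMatrix (outerGraph G j s) (outerConditions Γ j) (outerGraph G j s).inner z =
      Matrix.fromBlocks (Matrix.diagonal fun _ => 0) (Matrix.diagonal fun _ => (solZ G Γ z j j).1 s)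
        (Matrix.diagonal fun _ => 1) (Matrix.diagonal fun _ => (solZ G Γ z j j).2 s) := by
    rw [fundamentalMatrix]
    congr 1 <;> ext k i <;> fin_cases k <;> fin_cases i
    · exact h1.trans (by simp [outerConditions])
    · exact hZ.1.trans (by simp)
    · exact h2.trans (by simp [outerConditions])
    · exact hZ.2.trans (by simp)
  rw [evans, hM, det_fromBlocks_diagonal]
  simp

/-- At the points `x_j = s` and `x_k = outer k`, the `Y` columns agree by uniqueness from the
central vertex, and the `Z` columns with index other than `j` are equal boundary data. Only column
`j` of `Z` differs. The second equation writes the inner matrix as its own column update, ready for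
linearity of the determinant. -/
lemma fundamentalMatrix_innerGraph (hG : G.IsRegular) (hs : s ∈ Ioo (G.inner j) (G.outer j))
    (hΓ : Γ.IsSelfAdjoint) (z : ℂ) :
    fundamentalMatrix G Γ (innerGraph G j s).outer z =
      (fundamentalMatrix (innerGraph G j s) (innerConditions Γ j) (innerGraph G j s).outer
        z).updateCol (Sum.inr j)
        ((solZ G Γ z j j).1 s • Pi.single (Sum.inl j) 1 +
          (solZ G Γ z j j).2 s • Pi.single (Sum.inr j) 1) ∧
    fundamentalMatrix (innerGraph G j s) (innerConditions Γ j) (innerGraph G j s).outer z =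
      (fundamentalMatrix (innerGraph G j s) (innerConditions Γ j) (innerGraph G j s).outer
        z).updateCol (Sum.inr j) (Pi.single (Sum.inr j) 1) := by
  have hR := isRegular_innerGraph hG hs
  set x := (innerGraph G j s).outer with hx
  have hxj : x j = s := by simp [hx, innerGraph]
  have hxk : ∀ k, k ≠ j → x k = G.outer k := fun k hk => by simp [hx, innerGraph, hk]
  have hp := isPoint_innerGraph_outer hG hs
  have hY : ∀ k i,
      (solY G Γ z k i).1 (x k) = (solY (innerGraph G j s) (innerConditions Γ j) z k i).1 (x k) ∧
      (solY G Γ z k i).2 (x k) =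
        (solY (innerGraph G j s) (innerConditions Γ j) z k i).2 (x k) := by
    intro k i
    obtain ⟨h, h1, h2⟩ := isIVPSolution_ivpSolution (hG.lt k) (hG.integrableOn k) z
      ((-Γ.α₂.conjTranspose) k i) (Γ.α₁.conjTranspose k i) (hG.left_mem k)
    have l := isIVPSolution_ivpSolution (hR.lt k) (hR.integrableOn k) z
      ((-Γ.α₂.conjTranspose) k i) (Γ.α₁.conjTranspose k i) (hR.left_mem k)
    exact IsIVPSolution.eq_of_eq (hR.lt k) (hR.integrableOn k) (hR.left_mem k)
      ⟨h.restrict (hG.left_mem k) (hp k).2, h1, h2⟩ l _ (hR.right_mem k)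
  have hβ : ∀ {M : Matrix ι ι ℂ}, M.IsDiag → ∀ k i, k ≠ i → M.conjTranspose k i = 0 :=
    fun hM k i hki => by rw [Matrix.conjTranspose_apply, hM hki.symm, star_zero]
  -- Diagonal `β` matrices give zero Cauchy data off the diagonal, so `Z` is diagonal at every
  -- point.
  have hZ0 : ∀ k i, k ≠ i → (solZ G Γ z k i).1 (x k) = 0 ∧ (solZ G Γ z k i).2 (x k) = 0 := by
    intro k i hki
    obtain ⟨h, h1, h2⟩ := isIVPSolution_ivpSolution (hG.lt k) (hG.integrableOn k) z
      ((-Γ.β₂.conjTranspose) k i) (Γ.β₁.conjTranspose k i) (hG.right_mem k)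
    exact h.eq_zero_of_point (hG.lt k) (hG.integrableOn k) (hG.right_mem k)
      (h1.trans (by rw [Matrix.neg_apply, hβ hΓ.diag_β₂ k i hki, neg_zero]))
      (h2.trans (hβ hΓ.diag_β₁ k i hki)) _ (hp k)
  have hZ1 : ∀ k, k ≠ j →
      (solZ G Γ z k k).1 (x k) = -star (Γ.β₂ k k) ∧ (solZ G Γ z k k).2 (x k) = star (Γ.β₁ k k) := by
    intro k hk
    obtain ⟨h, h1, h2⟩ := isIVPSolution_ivpSolution (hG.lt k) (hG.integrableOn k) z
      ((-Γ.β₂.conjTranspose) k k) (Γ.β₁.conjTranspose k k) (hG.right_mem k)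
    rw [hxk k hk]
    exact ⟨h1, h2⟩
  have hZ2 : ∀ k i,
      (solZ (innerGraph G j s) (innerConditions Γ j) z k i).1 (x k) =
        (-(innerConditions Γ j).β₂.conjTranspose) k i ∧
      (solZ (innerGraph G j s) (innerConditions Γ j) z k i).2 (x k) =
        (innerConditions Γ j).β₁.conjTranspose k i := by
    intro k i
    exact (isIVPSolution_ivpSolution (hR.lt k) (hR.integrableOn k) z
      ((-(innerConditions Γ j).β₂.conjTranspose) k i) ((innerConditions Γ j).β₁.conjTranspose k i)
      (hR.right_mem k)).2
  have hΓ' := isSelfAdjoint_innerConditions hΓ j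
  have hb2 : ∀ k i, (-(innerConditions Γ j).β₂.conjTranspose) k i =
      if k = i then (if k = j then 0 else -star (Γ.β₂ k k)) else 0 := by
    intro k i
    split_ifs with h1 h2
    · subst h1 h2; simp [innerConditions]
    · subst h1; simp [innerConditions, h2]
    · rw [Matrix.neg_apply, hβ hΓ'.diag_β₂ k i h1, neg_zero]
  have hb1 : ∀ k i, (innerConditions Γ j).β₁.conjTranspose k i =
      if k = i then (if k = j then 1 else star (Γ.β₁ k k)) else 0 := by
    intro k i
    split_ifs with h1 h2
    · subst h1 h2; simp [innerConditions]
    · subst h1; simp [innerConditions, h2]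
    · exact hβ hΓ'.diag_β₁ k i h1
  simp only [hb1, hb2] at hZ2
  constructor
  · ext r c
    rcases c with i | i
    · rw [Matrix.updateCol_ne (by simp)]
      rcases r with k | k
      · exact (hY k i).1
      · exact (hY k i).2
    · rcases eq_or_ne i j with rfl | hi
      · rw [Matrix.updateCol_self]
        rcases r with k | k <;> rcases eq_or_ne k i with rfl | hk
        · simp [fundamentalMatrix, hxj]
        · simp [fundamentalMatrix, (hZ0 k i hk).1, hk]
        · simp [fundamentalMatrix, hxj]
        · simp [fundamentalMatrix, (hZ0 k i hk).2, hk]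
      · rw [Matrix.updateCol_ne (by simpa using hi)]
        rcases r with k | k <;> rcases eq_or_ne k i with rfl | hk
        · exact (hZ1 k hi).1.trans (by rw [fundamentalMatrix]; simp [(hZ2 k k).1, hi])
        · exact (hZ0 k i hk).1.trans (by rw [fundamentalMatrix]; simp [(hZ2 k i).1, hk])
        · exact (hZ1 k hi).2.trans (by rw [fundamentalMatrix]; simp [(hZ2 k k).2, hi])
        · exact (hZ0 k i hk).2.trans (by rw [fundamentalMatrix]; simp [(hZ2 k i).2, hk])
  · ext r c
    rcases eq_or_ne c (Sum.inr j) with rfl | hc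
    · rw [Matrix.updateCol_self]
      rcases r with k | k <;> rcases eq_or_ne k j with rfl | hk
      · simp [fundamentalMatrix, (hZ2 k k).1]
      · simp [fundamentalMatrix, (hZ2 k j).1, hk]
      · simp [fundamentalMatrix, (hZ2 k k).2]
      · simp [fundamentalMatrix, (hZ2 k j).2, hk]
    · rw [Matrix.updateCol_ne hc]

/-- The determinant of the fundamental matrix of the inner piece in which the column of the end `s`
of edge `j` is replaced by Neumann data. -/
def neumannDet (G : StarGraph ι) (Γ : BoundaryConditions ι) (j : ι) (s : ℝ) (z : ℂ) : ℂ :=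
  ((fundamentalMatrix (innerGraph G j s) (innerConditions Γ j) (innerGraph G j s).outer
    z).updateCol (Sum.inr j) (Pi.single (Sum.inl j) 1)).det

lemma evans_eq_neumannDet_add (hG : G.IsRegular) (hs : s ∈ Ioo (G.inner j) (G.outer j))
    (hΓ : Γ.IsSelfAdjoint) (z : ℂ) :
    evans G Γ (innerGraph G j s).outer z =
      (solZ G Γ z j j).1 s * neumannDet G Γ j s z + (solZ G Γ z j j).2 s *
        evans (innerGraph G j s) (innerConditions Γ j) (innerGraph G j s).outer z := by
  obtain ⟨h1, h2⟩ := fundamentalMatrix_innerGraph hG hs hΓ z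
  rw [evans, h1, Matrix.det_updateCol_add, Matrix.det_updateCol_smul, Matrix.det_updateCol_smul, ← h2]
  rfl

/-- `u` is a multiple of `ζ = z_j`, so its data at `s` are proportional to those of `ζ`. The
cross-multiplied form needs no `ζ(s) ≠ 0`. -/
lemma IsBVPSolution.outer_relation (hG : G.IsRegular) (hs : s ∈ Ioo (G.inner j) (G.outer j))
    (hΓ : Γ.IsSelfAdjoint) {f : ℂ} {u u' : Fin 1 → ℝ → ℂ}
    (h : IsBVPSolution (outerGraph G j s) (outerConditions Γ j) z (outerData f) u u') :
    u' 0 s * (solZ G Γ z j j).1 s = f * (solZ G Γ z j j).2 s := by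
  have hR := isRegular_outerGraph hG hs
  have hf : u 0 s = f := by
    have := congrFun h.2 (Sum.inr 0)
    simpa [trace, outerConditions, outerGraph, outerData] using this
  obtain ⟨d, d1, d2⟩ := (trace_inl_eq_zero_iff (isSelfAdjoint_outerConditions hΓ j)).1
    (funext fun i => (congrFun h.2 (Sum.inl i)).trans (by simp [outerData]))
  have hZ := isIVPSolution_sum_solZ hR (outerConditions Γ j) z d 0
  obtain ⟨e1, e2⟩ := (h.1 0).eq_of_point (hR.lt 0) (hR.integrableOn 0) hZ.1 (hR.right_mem 0)
    ((d1 0).trans hZ.2.1.symm) ((d2 0).trans hZ.2.2.symm) s (left_mem_Icc.2 hs.2.le)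
  obtain ⟨z1, z2⟩ := solZ_outerGraph hG hs Γ z s (left_mem_Icc.2 hs.2.le)
  simp only [Finset.univ_unique, Fin.default_eq_zero, Fin.isValue, Finset.sum_singleton,
    Prod.smul_fst, Prod.smul_snd, Pi.smul_apply, smul_eq_mul, z1, z2] at e1 e2
  rw [← hf, e1, e2]
  ring

/-- Cramer's rule for `F (c, -d) = f e_j`, read in the coordinate of `-d_j = -u_j'(s)`. -/
lemma IsBVPSolution.inner_relation (hG : G.IsRegular) (hs : s ∈ Ioo (G.inner j) (G.outer j))
    (hΓ : Γ.IsSelfAdjoint) {f : ℂ} {u u' : ι → ℝ → ℂ}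
    (h : IsBVPSolution (innerGraph G j s) (innerConditions Γ j) z (innerData j f) u u') :
    u' j s * evans (innerGraph G j s) (innerConditions Γ j) (innerGraph G j s).outer z =
      -(f * neumannDet G Γ j s z) := by
  have hR := isRegular_innerGraph hG hs
  have hΓ' := isSelfAdjoint_innerConditions hΓ j
  set x := (innerGraph G j s).outer with hx
  have hxj : x j = s := by simp [hx, innerGraph]
  obtain ⟨c, c1, c2⟩ := (trace_inr_eq_zero_iff hΓ').1
    (funext fun i => (congrFun h.2 (Sum.inr i)).trans (by simp [innerData]))
  -- The new `β₁` fixes the `j`-th unit vector, so subtracting `f` from the `j`-th value makes the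
  -- outer conditions homogeneous.
  obtain ⟨d, d1, d2⟩ := exists_eq_conjTranspose_mulVec hΓ'.rank_β hΓ'.comm_β
    (p := (fun i => u i (x i)) - Pi.single j f) (q := fun i => u' i (x i)) (by
      have h1 : (innerConditions Γ j).β₁.mulVec (Pi.single j f) = Pi.single j f := by
        ext i
        rw [innerConditions, Matrix.mulVec_diagonal]
        rcases eq_or_ne i j with rfl | hi
        · simp
        · simp [hi]
      rw [Matrix.mulVec_sub, h1, sub_add_eq_add_sub, sub_eq_zero]
      ext i
      refine (congrFun h.2 (Sum.inl i)).trans ?_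
      rcases eq_or_ne i j with rfl | hi
      · simp [innerData]
      · simp [innerData, hi])
  have hd : u' j s = d j := by
    have := congrFun d2 j
    simp only [hxj] at this
    rw [this, innerConditions, Matrix.diagonal_conjTranspose, Matrix.mulVec_diagonal]
    simp
  have hY := fun k => isIVPSolution_sum_solY hR (innerConditions Γ j) z c k
  have hZ := fun k => isIVPSolution_sum_solZ hR (innerConditions Γ j) z (-d) k
  have hYu := fun k => (h.1 k).eq_of_point (hR.lt k) (hR.integrableOn k) (hY k).1 (hR.left_mem k)
    ((c1 k).trans (hY k).2.1.symm) ((c2 k).trans (hY k).2.2.symm) _ (hR.right_mem k)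
  have hker : (fundamentalMatrix (innerGraph G j s) (innerConditions Γ j) x z).mulVec
      (Sum.elim c (-d)) = f • Pi.single (Sum.inl j) 1 := by
    rw [fundamentalMatrix_mulVec]
    ext (k | k)
    · rw [Sum.elim_inl, ← (hYu k).1, (hZ k).2.1, Matrix.mulVec_neg, ← d1, Pi.neg_apply, Pi.sub_apply]
      rcases eq_or_ne k j with rfl | hk
      · simp [hx]
      · simp [hx, hk]
    · rw [Sum.elim_inr, ← (hYu k).2, (hZ k).2.2, Matrix.mulVec_neg, ← d2, Pi.neg_apply]
      simp [hx]
  -- Multiplying by the adjugate instead of the inverse keeps the relation free of division.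
  have hcr := congrFun (congrArg (Matrix.mulVec (Matrix.adjugate (fundamentalMatrix (innerGraph G j s)
    (innerConditions Γ j) x z))) hker) (Sum.inr j)
  rw [Matrix.mulVec_mulVec, Matrix.adjugate_mul, Matrix.smul_mulVec, Matrix.one_mulVec,
    Matrix.mulVec_smul, ← Matrix.cramer_eq_adjugate_mulVec, Pi.smul_apply, Pi.smul_apply,
    Matrix.cramer_apply, Sum.elim_inr, Pi.neg_apply, smul_eq_mul, smul_eq_mul] at hcr
  rw [hd]
  change _ * evans _ _ _ _ = -(f * Matrix.det _)
  rw [← hcr, evans]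
  ring

theorem twoSidedMap_eq (hG : G.IsRegular) (hs : s ∈ Ioo (G.inner j) (G.outer j))
    (hΓ : Γ.IsSelfAdjoint)
    (hE₁ : evans (outerGraph G j s) (outerConditions Γ j) (outerGraph G j s).inner z ≠ 0)
    (hE₂ : evans (innerGraph G j s) (innerConditions Γ j) (innerGraph G j s).inner z ≠ 0) (f : ℂ) :
    twoSidedMap G Γ j s z f = evans G Γ G.inner z /
      (evans (outerGraph G j s) (outerConditions Γ j) (outerGraph G j s).inner z *
        evans (innerGraph G j s) (innerConditions Γ j) (innerGraph G j s).inner z) * f := by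
  have hR₁ := isRegular_outerGraph hG hs
  have hR₂ := isRegular_innerGraph hG hs
  obtain ⟨u₁, u₁', h₁⟩ := (hasUniqueBVPSolution hR₁ (isSelfAdjoint_outerConditions hΓ j) hE₁
    (outerData f)).1
  obtain ⟨u₂, u₂', h₂⟩ := (hasUniqueBVPSolution hR₂ (isSelfAdjoint_innerConditions hΓ j) hE₂
    (innerData j f)).1
  have e₁ : ∃ w : (Fin 1 → ℝ → ℂ) × (Fin 1 → ℝ → ℂ),
      IsBVPSolution (outerGraph G j s) (outerConditions Γ j) z (outerData f) w.1 w.2 :=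
    ⟨(u₁, u₁'), h₁⟩
  have e₂ : ∃ w : (ι → ℝ → ℂ) × (ι → ℝ → ℂ),
      IsBVPSolution (innerGraph G j s) (innerConditions Γ j) z (innerData j f) w.1 w.2 :=
    ⟨(u₂, u₂'), h₂⟩
  -- The relations hold for every solution, hence for those chosen in the definitions of the
  -- one-sided maps.
  have r₁ := e₁.choose_spec.outer_relation hG hs hΓ
  have r₂ := e₂.choose_spec.inner_relation hG hs hΓ
  have hp₂ : evans (innerGraph G j s) (innerConditions Γ j) (innerGraph G j s).outer z =
      evans (innerGraph G j s) (innerConditions Γ j) (innerGraph G j s).inner z :=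
    evans_eq_inner hR₂ _ (fun i => hR₂.right_mem i) z
  rw [twoSidedMap, outerMap, dif_pos e₁, innerMap, dif_pos e₂,
    ← evans_eq_inner hG Γ (isPoint_innerGraph_outer hG hs), evans_eq_neumannDet_add hG hs hΓ, hp₂]
  rw [hp₂] at r₂
  rw [evans_outerGraph hG hs, neg_ne_zero] at hE₁
  rw [evans_outerGraph hG hs]
  field_simp
  linear_combination -(evans (innerGraph G j s) (innerConditions Γ j) (innerGraph G j s).inner z) * r₁
    + (solZ G Γ z j j).1 s * r₂

end

end QuantumStar

/-! ### The theorem for a star graph with edges `[0, ℓ_i]` -/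

theorem mainTheorem1 (n : ℕ) (Ω : StarGraph (Fin n)) (hinner : ∀ i, Ω.inner i = 0)
    (houter : ∀ i, 0 < Ω.outer i)
    (hV : ∀ i, IntegrableOn (Ω.potential i) (Ioo 0 (Ω.outer i)))
    (Γ : BoundaryConditions (Fin n)) (hΓ : Γ.IsSelfAdjoint)
    (j : Fin n) (s₁ : ℝ) (hs₁ : s₁ ∈ Ioo 0 (Ω.outer j))
    (Ω₁ : StarGraph (Fin 1)) (hΩ₁ : Ω₁ = outerGraph Ω j s₁)
    (Ω₂ : StarGraph (Fin n)) (hΩ₂ : Ω₂ = innerGraph Ω j s₁)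
    (Γ₁ : BoundaryConditions (Fin 1)) (hΓ₁ : Γ₁ = outerConditions Γ j)
    (Γ₂ : BoundaryConditions (Fin n)) (hΓ₂ : Γ₂ = innerConditions Γ j)
    (ρ : Set ℂ) (hρ : ρ = operatorResolventSet (schrodinger Ω₁ Γ₁) ∩
      operatorResolventSet (schrodinger Ω₂ Γ₂)) :
    -- the boundary value problems that define the one-sided maps are uniquely solvable
    (∀ z ∈ ρ, ∀ f : ℂ,
      HasUniqueBVPSolution Ω₁ Γ₁ z (outerData f) ∧
      HasUniqueBVPSolution Ω₂ Γ₂ z (innerData j f)) ∧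
    -- the points `x, x₁, x₂` at which the Evans functions are computed do not matter
    ∀ (x : Fin n → ℝ) (x₁ : Fin 1 → ℝ) (x₂ : Fin n → ℝ),
      IsPoint Ω x → IsPoint Ω₁ x₁ → IsPoint Ω₂ x₂ →
      -- the equality on the common resolvent set
      (∀ z ∈ ρ,
        evans Ω₁ Γ₁ x₁ z ≠ 0 ∧ evans Ω₂ Γ₂ x₂ z ≠ 0 ∧
        ∀ f : ℂ, twoSidedMap Ω Γ j s₁ z f =
          evans Ω Γ x z / (evans Ω₁ Γ₁ x₁ z * evans Ω₂ Γ₂ x₂ z) * f) ∧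
      -- the equality of meromorphic functions on the complex plane
      ρ ∈ codiscrete ℂ ∧
      Meromorphic (fun z => evans Ω Γ x z / (evans Ω₁ Γ₁ x₁ z * evans Ω₂ Γ₂ x₂ z)) ∧
      Meromorphic (fun z => twoSidedMap Ω Γ j s₁ z 1) ∧
      (fun z => evans Ω Γ x z / (evans Ω₁ Γ₁ x₁ z * evans Ω₂ Γ₂ x₂ z))
        =ᶠ[codiscrete ℂ] fun z => twoSidedMap Ω Γ j s₁ z 1 := by

  subst hΩ₁ hΩ₂ hΓ₁ hΓ₂ hρ
  have hG : Ω.IsRegular := ⟨fun i => by rw [hinner i]; exact houter i, fun i => by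
    rw [hinner i]; exact hV i⟩
  have hs : s₁ ∈ Ioo (Ω.inner j) (Ω.outer j) := by rw [hinner j]; exact hs₁
  have hR₁ := isRegular_outerGraph hG hs
  have hR₂ := isRegular_innerGraph hG hs
  have hS₁ := isSelfAdjoint_outerConditions hΓ j
  have hS₂ := isSelfAdjoint_innerConditions hΓ j
  refine ⟨fun z hz f => ⟨hasUniqueBVPSolution hR₁ hS₁ ((mem_resolventSet_iff hR₁ hS₁).1 hz.1) _,
    hasUniqueBVPSolution hR₂ hS₂ ((mem_resolventSet_iff hR₂ hS₂).1 hz.2) _⟩,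
    fun x x₁ x₂ hx hx₁ hx₂ => ?_⟩
  set ρ := operatorResolventSet (schrodinger (outerGraph Ω j s₁) (outerConditions Γ j)) ∩
    operatorResolventSet (schrodinger (innerGraph Ω j s₁) (innerConditions Γ j))
  have hcod : ρ ∈ codiscrete ℂ :=
    inter_mem (resolventSet_mem_codiscrete hR₁ hS₁) (resolventSet_mem_codiscrete hR₂ hS₂)
  have main : ∀ z ∈ ρ, evans (outerGraph Ω j s₁) (outerConditions Γ j) x₁ z ≠ 0 ∧
      evans (innerGraph Ω j s₁) (innerConditions Γ j) x₂ z ≠ 0 ∧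
      ∀ f : ℂ, twoSidedMap Ω Γ j s₁ z f = evans Ω Γ x z /
        (evans (outerGraph Ω j s₁) (outerConditions Γ j) x₁ z *
          evans (innerGraph Ω j s₁) (innerConditions Γ j) x₂ z) * f := by
    intro z hz
    have h₁ := (mem_resolventSet_iff hR₁ hS₁).1 hz.1
    have h₂ := (mem_resolventSet_iff hR₂ hS₂).1 hz.2
    rw [evans_eq_inner hG Γ hx, evans_eq_inner hR₁ _ hx₁, evans_eq_inner hR₂ _ hx₂]
    exact ⟨h₁, h₂, twoSidedMap_eq hG hs hΓ h₁ h₂⟩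
  have heq : (fun z => evans Ω Γ x z / (evans (outerGraph Ω j s₁) (outerConditions Γ j) x₁ z *
      evans (innerGraph Ω j s₁) (innerConditions Γ j) x₂ z))
        =ᶠ[codiscrete ℂ] fun z => twoSidedMap Ω Γ j s₁ z 1 := by
    filter_upwards [hcod] with z hz
    rw [(main z hz).2.2 1, mul_one]
  have hmer : Meromorphic (fun z => evans Ω Γ x z /
      (evans (outerGraph Ω j s₁) (outerConditions Γ j) x₁ z *
        evans (innerGraph Ω j s₁) (innerConditions Γ j) x₂ z)) := fun z =>
    ((differentiable_evans hG Γ hx).analyticAt z).meromorphicAt.fun_div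
      (((differentiable_evans hR₁ _ hx₁).analyticAt z).meromorphicAt.fun_mul
        ((differentiable_evans hR₂ _ hx₂).analyticAt z).meromorphicAt)
  -- Equality on a codiscrete set gives equality in a punctured neighbourhood of every point, so
  -- meromorphy carries over whatever values the two-sided map takes outside `ρ`.
  refine ⟨main, hcod, hmer, fun z => (hmer z).congr ?_, heq⟩
  simpa [EventuallyEq, Filter.Eventually] using
    mem_codiscreteWithin_iff_forall_mem_nhdsNE.1 heq z trivial
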